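/- Let $R$ be a connected oriented metric ribbon graph, all of whose vertices have degree at least $3$, and suppose that $R$ has at least two vertices. Thus $R$ is given by a finite set $X$ of half-edges, a permutation $s_0$ of $X$ whose cycles are the vertices, a fixed-point free involution $s_1$ of $X$ whose cycles are the edges, positive edge lengths, and a map $\epsilon\colon X\to\{\pm1\}$ with $\epsilon\circ s_2=\epsilon$ and $\epsilon\circ s_1=-\epsilon$, where $s_2=s_1 s_0^{-1}$; the cycles of $s_2$ are the boundaries of the associated surface $M_R$, and $\epsilon$ gives each of them a sign. A multi-curve $\Gamma$ on $R$ is an isotopy class of finite families (possibly empty) of disjoint, pairwise non-isotopic simple closed curves on $M_R$, none of which is contractible or homotopic to a boundary. Cutting $M_R$ along $\Gamma$, in minimal position, cuts $R$ into a ribbon graph $R_\Gamma$ on the cut surface (parallel edges being identified, so that $R_\Gamma$ has no vertex of degree two), each vertex of which is cut out of a vertex of $R$. The multi-curve $\Gamma$ is admissible if it splits no vertex, that is, if distinct vertices of $R_\Gamma$ come from distinct vertices of $R$. The stable graph of $\Gamma$ has as vertices the connected components of the cut surface and as edges the curves of $\Gamma$, each of which glues two boundaries of the cut surface. If $\Gamma$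 is admissible, $R_\Gamma$ inherits the orientation of $R$, so that every boundary of the cut surface has a sign. Then for every vertex $v$ of $R$ there is a unique admissible multi-curve $\Gamma_v^+$ whose stable graph has a component $c_0$ such that: 1. $c_0$ separates $v$ from the rest of the surface: $c_0$ contains $v$ and no other vertex of $R$; 2. every curve of $\Gamma_v^+$ is a boundary of $c_0$; 3. $c_0$ is glued to the rest of the surface along negative boundaries: every boundary of $c_0$ that comes from a curve of $\Gamma_v^+$ is negative. -/

import Mathlib

/-- A combinatorial ribbon graph with set of half-edges `X`: `s0` rotates the half-edges around
their vertices and `s1` exchanges the two halves of an edge.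

A half-edge `e` is also read as an edge oriented away from its vertex. The pictures in the comments
below use the convention that `s0` is the clockwise rotation. -/
structure RibbonGraph (X : Type*) where
  s0 : Equiv.Perm X
  s1 : Equiv.Perm X
  s1_s1 : ∀ e, s1 (s1 e) = e
  s1_ne : ∀ e, s1 e ≠ e

namespace RibbonGraph

variable {X : Type*} (R : RibbonGraph X)

/-- The boundary permutation, `s0 * s1 * s2 = 1`. -/
def s2 : Equiv.Perm X := R.s1 * R.s0⁻¹

/-- Vertices: the cycles of `s0`. -/
def Vertex : Type _ := Quotient (Equiv.Perm.SameCycle.setoid R.s0)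

/-- Boundary components of the surface of the ribbon graph: the cycles of `s2`. -/
def Boundary : Type _ := Quotient (Equiv.Perm.SameCycle.setoid R.s2)

/-- Connected components: the orbits of the group generated by `s0` and `s1`. -/
def Component : Type _ :=
  Quotient (MulAction.orbitRel (Subgroup.closure {R.s0, R.s1}) X)

/-- The vertex to which a half-edge is attached. -/
def vertex (e : X) : R.Vertex := Quotient.mk _ e

/-- The boundary component that runs along the left side of `e` (through the corner between
`s0⁻¹ e` and `e`). -/
def boundary (e : X) : R.Boundary := Quotient.mk _ e

/-- The connected component of a half-edge. -/
def component (e : X) : R.Component := Quotient.mk _ e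

/-- The degree of a vertex. -/
noncomputable def degree (v : R.Vertex) : ℕ := {e : X | R.vertex e = v}.ncard

/-- The ribbon graph (equivalently, its surface) is connected. -/
def Connected : Prop := Nonempty R.Component ∧ Subsingleton R.Component

theorem component_zpow_eq {g : Equiv.Perm X} (hg : g ∈ Subgroup.closure {R.s0, R.s1})
    {a b : X} (h : g.SameCycle a b) : R.component a = R.component b := by
  obtain ⟨n, rfl⟩ := h
  refine (Quotient.sound ?_ : R.component ((g ^ n) a) = R.component a).symm
  exact ⟨⟨g ^ n, Subgroup.zpow_mem _ hg n⟩, rfl⟩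

theorem s0_mem : R.s0 ∈ Subgroup.closure {R.s0, R.s1} :=
  Subgroup.subset_closure (by simp)

theorem s2_mem : R.s2 ∈ Subgroup.closure {R.s0, R.s1} :=
  Subgroup.mul_mem _ (Subgroup.subset_closure (by simp)) (Subgroup.inv_mem _ R.s0_mem)

/-- The connected component of a vertex. -/
def vertexComponent : R.Vertex → R.Component :=
  Quotient.lift R.component fun _ _ h => R.component_zpow_eq R.s0_mem h

/-- The connected component of a boundary. -/
def boundaryComponent : R.Boundary → R.Component :=
  Quotient.lift R.component fun _ _ h => R.component_zpow_eq R.s2_mem h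

/-! ### Multi-curves

The surface `M_R` of a ribbon graph consists of one disc per vertex and one band per edge. An isotopy
class of multi-curves of `M_R` (disjoint, pairwise non isotopic, essential simple closed curves) has a
representative, unique up to isotopies preserving the bands, that crosses the bands in parallel strands
and none of whose arcs in a vertex disc comes back to the band from which it enters. This is recorded as
follows: `y e` strands cross the band of `e`, the one in position `i < y e`, counted from the left of
`e`, leaves the vertex disc at the point `(e, i)`, and `turn` exchanges the two endpoints of each arc
in a vertex disc. -/

section StrandDiagram

variable (y : X → ℕ) (turn : X × ℕ → X × ℕ)

/-- The strand `p`, read in the opposite direction. -/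
def reverseStrand (p : X × ℕ) : X × ℕ := (R.s1 p.1, y p.1 - 1 - p.2)

/-- Follow the curve: the strand `p` leaves its vertex, crosses the edge `p.1` and turns in the vertex
disc at the other end, from which it leaves as the strand `nextStrand p`. -/
def nextStrand (p : X × ℕ) : X × ℕ := turn (R.reverseStrand y p)

/-- The sequence of oriented edges followed by the curve that starts with the strand `p`: its
combinatorial representation. -/
def word (p : X × ℕ) (k : ℕ) : X := ((R.nextStrand y turn)^[k] p).1

/-- `p` and `q` are strands of the same (unoriented) curve. -/
def SameCurve (p q : X × ℕ) : Prop :=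
  ∃ k : ℕ, q = (R.nextStrand y turn)^[k] p ∨
    q = (R.nextStrand y turn)^[k] (R.reverseStrand y p)

/-- The `y e` strands cut the band of `e` into `y e + 1` strips `(e, 0), …, (e, y e)`, from left to
right; the strand `(e, i)` lies between the strips `(e, i)` and `(e, i + 1)`. This is the map from a
strip to the next one in the clockwise order around the vertex. -/
def clockwise (a : X × ℕ) : X × ℕ := if a.2 < y a.1 then (a.1, a.2 + 1) else (R.s0 a.1, 0)

/-- Turning clockwise around the vertex from the strand `p`, one meets the strand `q` strictly before
the strand `r`. -/
def InArc (p r q : X × ℕ) : Prop :=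
  ∃ k : ℕ, (R.clockwise y)^[k] (p.1, p.2 + 1) = q ∧
    ∀ l ≤ k, (R.clockwise y)^[l] (p.1, p.2 + 1) ≠ r

end StrandDiagram

/-- A primitive multi-curve on the surface of `R`, up to isotopy. -/
@[ext]
structure MultiCurve where
  /-- number of intersections with the arc dual to an edge -/
  y : X → ℕ
  y_s1 : ∀ e, y (R.s1 e) = y e
  turn : X × ℕ → X × ℕ
  /-- `turn` has no meaning, and is the identity, on pairs which are not strands -/
  turn_junk : ∀ p, ¬ p.2 < y p.1 → turn p = p
  turn_lt : ∀ p, p.2 < y p.1 → (turn p).2 < y (turn p).1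
  turn_turn : ∀ p, turn (turn p) = p
  /-- an arc joins two bands of the same vertex disc -/
  turn_vertex : ∀ p, R.vertex (turn p).1 = R.vertex p.1
  /-- the representative is minimal: no arc comes back to the band from which it enters -/
  turn_reduced : ∀ p, p.2 < y p.1 → (turn p).1 ≠ p.1
  /-- the curves are simple and disjoint: the arcs in a vertex disc do not cross -/
  noncrossing : ∀ p q, p.2 < y p.1 → q.2 < y q.1 →
    R.InArc y p (turn p) q → R.InArc y p (turn p) (turn q)
  /-- no curve is homotopic to a boundary: none follows forever the left side of its edges (the same
  curve read backwards takes care of the right side) -/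
  essential : ∀ p, p.2 < y p.1 →
    ¬ ∀ k, R.s2 (R.word y turn p (k + 1)) = R.word y turn p k
  /-- distinct curves are not isotopic, i.e. do not have the same combinatorial representation -/
  primitive : ∀ p q, p.2 < y p.1 → q.2 < y q.1 →
    (∀ k, R.word y turn p k = R.word y turn q k) → R.SameCurve y turn p q

namespace MultiCurve

variable {R} (Γ : R.MultiCurve)

/-- The strips into which the curves cut the bands. -/
abbrev Strip : Type _ := {a : X × ℕ // a.2 ≤ Γ.y a.1}

/-- Rotation of the strips around the regions into which the curves cut the vertex discs: on the right
of the strip `(e, i)` there is either the strand `(e, i)`, whose arc the region follows, or, if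
`i = y e`, the corner of the vertex disc after `e`. -/
def cutS0 : Equiv.Perm Γ.Strip where
  toFun a := if h : a.1.2 < Γ.y a.1.1
    then ⟨((Γ.turn a.1).1, (Γ.turn a.1).2 + 1), Γ.turn_lt _ h⟩
    else ⟨(R.s0 a.1.1, 0), Nat.zero_le _⟩
  invFun a := if h : a.1.2 = 0
    then ⟨(R.s0.symm a.1.1, Γ.y (R.s0.symm a.1.1)), le_rfl⟩
    else ⟨Γ.turn (a.1.1, a.1.2 - 1),
      (Γ.turn_lt (a.1.1, a.1.2 - 1)
        (show a.1.2 - 1 < Γ.y a.1.1 by have := a.2; omega)).le⟩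
  left_inv := by
    rintro ⟨⟨e, i⟩, hi⟩
    by_cases h : i < Γ.y e
    · simp [h, Γ.turn_turn]
    · have hi' : i ≤ Γ.y e := hi
      have : i = Γ.y e := by omega
      subst this
      simp
  right_inv := by
    rintro ⟨⟨e, i⟩, hi⟩
    have hi' : i ≤ Γ.y e := hi
    by_cases h : i = 0
    · subst h; simp
    · have h1 : i - 1 < Γ.y e := by omega
      have h2 := Γ.turn_lt (e, i - 1) h1
      simp only [h, ↓reduceDIte, h2, Γ.turn_turn]
      apply Subtype.ext
      ext <;> simp
      omega

/-- The two ends of a strip. -/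
def cutS1 : Equiv.Perm Γ.Strip :=
  Function.Involutive.toPerm
    (fun a => ⟨(R.s1 a.1.1, Γ.y a.1.1 - a.1.2), by simp [Γ.y_s1]⟩) (by
    rintro ⟨⟨e, i⟩, hi⟩
    have hi' : i ≤ Γ.y e := hi
    apply Subtype.ext
    ext
    · simp [R.s1_s1]
    · simp [Γ.y_s1]; omega)

theorem coe_cutS1 (a : Γ.Strip) :
    (Γ.cutS1 a).1 = (R.s1 a.1.1, Γ.y a.1.1 - a.1.2) := rfl

theorem cutS1_cutS1 (a : Γ.Strip) : Γ.cutS1 (Γ.cutS1 a) = a :=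
  Function.Involutive.toPerm_involutive _ a

/-- The ribbon graph on the surface cut along `Γ`: its vertices are the regions of the vertex discs and
its edges are the strips. The vertices of degree two, which lie between parallel pieces of curves and
boundaries, are not erased here: they are only ignored, see `IsVertex`. -/
def cut : RibbonGraph Γ.Strip where
  s0 := Γ.cutS0
  s1 := Γ.cutS1
  s1_s1 := Γ.cutS1_cutS1
  s1_ne a h := R.s1_ne a.1.1 (congrArg (fun b : Γ.Strip => b.1.1) h)

/-- The genuine vertices of the cut ribbon graph `R_Γ` (no two of whose edges are parallel). -/
def IsVertex (w : Γ.cut.Vertex) : Prop := 3 ≤ Γ.cut.degree w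

theorem vertex_cutS0 (a : Γ.Strip) : R.vertex (Γ.cutS0 a).1.1 = R.vertex a.1.1 := by
  by_cases h : a.1.2 < Γ.y a.1.1
  · simp [cutS0, h, Γ.turn_vertex]
  · have : R.vertex (R.s0 a.1.1) = R.vertex a.1.1 := Quotient.sound ⟨-1, by simp⟩
    simp [cutS0, h, this]

/-- The vertex of `R` from whose disc a vertex of the cut ribbon graph has been cut out. -/
def baseVertex : Γ.cut.Vertex → R.Vertex :=
  Quotient.lift (fun a : Γ.Strip => R.vertex a.1.1) (by
    rintro a b ⟨n, rfl⟩
    have key : ∀ (n : ℤ) (a : Γ.Strip),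
        R.vertex ((Γ.cutS0 ^ n) a).1.1 = R.vertex a.1.1 := by
      intro n
      induction n with
      | zero => simp
      | succ k ih => intro a; rw [zpow_add_one, Equiv.Perm.mul_apply, ih, vertex_cutS0]
      | pred k ih =>
        intro a
        rw [zpow_sub_one, Equiv.Perm.mul_apply, ih, ← vertex_cutS0]; exact congrArg (fun b : Γ.Strip => R.vertex b.1.1) (Γ.cutS0.apply_symm_apply a)
    exact (key n a).symm)

/-- `Γ` is admissible if it splits no vertex: distinct vertices of the cut ribbon graph come from
distinct vertices of `R`. -/
def Admissible : Prop :=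
  ∀ w w', Γ.IsVertex w → Γ.IsVertex w' → Γ.baseVertex w = Γ.baseVertex w' → w = w'

/-! ### The stable graph

Its vertices are the components of the cut surface, its half-edges are the boundaries of the cut
surface, and the involution `glue` matches the two boundaries that come from the same curve. The
fixed points of `glue` are the boundaries of the original surface. -/

/-- The strip seen on the other side of the curve running along the left side of a strip. -/
def flip (a : Γ.Strip) : Γ.Strip :=
  if a.1.2 = 0 then a else Γ.cutS1 ⟨(a.1.1, a.1.2 - 1), (Nat.sub_le _ _).trans a.2⟩

theorem flip_s2 (a : Γ.Strip) : Γ.cut.s2.SameCycle (Γ.flip (Γ.cut.s2 a)) (Γ.flip a) := by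
  obtain ⟨⟨e, i⟩, hi⟩ := a
  have hi' : i ≤ Γ.y e := hi
  by_cases h : i = 0
  · subst h
    have h1 : Γ.flip (Γ.cut.s2 ⟨(e, 0), hi⟩) = Γ.cut.s2 ⟨(e, 0), hi⟩ := by
      have : (Γ.cut.s2 ⟨(e, 0), hi⟩).1.2 = 0 := by
        change (Γ.cutS1 (Γ.cutS0.symm ⟨(e, 0), hi⟩)).1.2 = 0
        rw [coe_cutS1]; simp [cutS0]
      simp [flip, this]
    have h2 : Γ.flip ⟨(e, 0), hi⟩ = ⟨(e, 0), hi⟩ := by simp [flip]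
    rw [h1, h2]
    exact ⟨-1, by simp⟩
  · refine ⟨1, ?_⟩
    have h1 : i - 1 < Γ.y e := by omega
    have h2 := Γ.turn_lt (e, i - 1) h1
    have h3 : Γ.flip (Γ.cut.s2 ⟨(e, i), hi⟩) =
        Γ.cutS0 ⟨(e, i - 1), h1.le⟩ := by
      have h4 : Γ.cut.s2 ⟨(e, i), hi⟩ = Γ.cutS1 ⟨Γ.turn (e, i - 1), h2.le⟩ := by
        change Γ.cutS1 (Γ.cutS0.symm ⟨(e, i), hi⟩) = _
        simp [cutS0, h]
      rw [h4]
      have h5 : (Γ.cutS1 ⟨Γ.turn (e, i - 1), h2.le⟩).1 =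
        (R.s1 (Γ.turn (e, i - 1)).1, Γ.y (Γ.turn (e, i - 1)).1 - (Γ.turn (e, i - 1)).2) := rfl
      have h6 : ¬ (Γ.cutS1 ⟨Γ.turn (e, i - 1), h2.le⟩).1.2 = 0 := by
        rw [h5]; simp only; omega
      rw [flip, if_neg h6]
      apply Subtype.ext
      have h7 : (Γ.cutS0 ⟨(e, i - 1), h1.le⟩).1 =
        ((Γ.turn (e, i - 1)).1, (Γ.turn (e, i - 1)).2 + 1) := by simp [cutS0, h1]
      rw [h7]
      ext
      · simp [coe_cutS1, R.s1_s1]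
      · simp [coe_cutS1, Γ.y_s1]; omega
    rw [h3, zpow_one]
    change Γ.cutS1 (Γ.cutS0⁻¹ (Γ.cutS0 _)) = _
    rw [flip, if_neg h]
    exact congrArg Γ.cutS1 (Γ.cutS0.symm_apply_apply _)

/-- The involution of the stable graph on the boundaries of the cut surface. -/
def glue : Γ.cut.Boundary → Γ.cut.Boundary :=
  Quotient.lift (fun a => Γ.cut.boundary (Γ.flip a)) (by
    rintro a b ⟨n, rfl⟩
    have step : ∀ a, Γ.cut.boundary (Γ.flip (Γ.cut.s2 a)) = Γ.cut.boundary (Γ.flip a) :=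
      fun a => Quotient.sound (Γ.flip_s2 a)
    have key : ∀ (n : ℤ) (a : Γ.Strip),
        Γ.cut.boundary (Γ.flip ((Γ.cut.s2 ^ n) a)) = Γ.cut.boundary (Γ.flip a) := by
      intro n
      induction n with
      | zero => simp
      | succ k ih => intro a; rw [zpow_add_one, Equiv.Perm.mul_apply, ih, step]
      | pred k ih =>
        intro a
        rw [zpow_sub_one, Equiv.Perm.mul_apply, ih, ← step]; exact congrArg (fun b => Γ.cut.boundary (Γ.flip b)) (Γ.cut.s2.apply_symm_apply a)
    exact (key n a).symm)

theorem flip_flip (a : Γ.Strip) : Γ.flip (Γ.flip a) = a := by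
  obtain ⟨⟨e, i⟩, hi⟩ := a
  have hi' : i ≤ Γ.y e := hi
  by_cases h : i = 0
  · simp [flip, h]
  · have h1 : ¬ Γ.y e - (i - 1) = 0 := by omega
    have h2 : Γ.flip ⟨(e, i), hi⟩ = Γ.cutS1 ⟨(e, i - 1), (Nat.sub_le _ _).trans hi⟩ :=
      if_neg h
    rw [h2, flip, if_neg (by rw [coe_cutS1]; exact h1)]
    apply Subtype.ext
    ext
    · simp [coe_cutS1, R.s1_s1]
    · simp [coe_cutS1, Γ.y_s1]; omega

theorem glue_glue (β : Γ.cut.Boundary) : Γ.glue (Γ.glue β) = β := by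
  induction β using Quotient.inductionOn with
  | _ a => exact congrArg Γ.cut.boundary (Γ.flip_flip a)

/-- The component `c₀` of the stable graph separates the vertex `v` from the rest of the surface: it
contains `v`, and no other vertex. -/
def SeparatesVertex (v : R.Vertex) (c₀ : Γ.cut.Component) : Prop :=
  (∃ w, Γ.IsVertex w ∧ Γ.baseVertex w = v ∧ Γ.cut.vertexComponent w = c₀) ∧
    ∀ w, Γ.IsVertex w → Γ.cut.vertexComponent w = c₀ → Γ.baseVertex w = v

/-- Every curve of `Γ` is a boundary of the component `c₀`. -/
def AllCurvesBound (c₀ : Γ.cut.Component) : Prop :=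
  ∀ β, Γ.glue β ≠ β →
    Γ.cut.boundaryComponent β = c₀ ∨ Γ.cut.boundaryComponent (Γ.glue β) = c₀

end MultiCurve

end RibbonGraph

/-- An oriented metric ribbon graph: `ε` is constant along the boundaries and changes sign when an edge
is reversed; every edge has a positive length. -/
structure OrientedMetricRibbonGraph (X : Type*) extends RibbonGraph X where
  ε : X → ℤˣ
  ε_s2 : ∀ e, ε (toRibbonGraph.s2 e) = ε e
  ε_s1 : ∀ e, ε (s1 e) = -ε e
  length : X → ℝ
  length_pos : ∀ e, 0 < length e
  length_s1 : ∀ e, length (s1 e) = length e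

namespace OrientedMetricRibbonGraph

variable {X : Type*} (S : OrientedMetricRibbonGraph X) (Γ : S.toRibbonGraph.MultiCurve)

/-- A boundary of the surface cut along `Γ` is negative for the orientation induced by that of `S`: the
edges of the cut ribbon graph inherit their orientation from the edges of `S`. -/
def IsNegative (β : Γ.cut.Boundary) : Prop :=
  ∀ a : Γ.Strip, Γ.cut.boundary a = β → S.ε a.1.1 = -1

/-- The component `c₀` is glued to the rest of the surface along negative boundaries only. -/
def GluedAlongNegative (c₀ : Γ.cut.Component) : Prop :=
  ∀ β, Γ.glue β ≠ β → Γ.cut.boundaryComponent β = c₀ → S.IsNegative Γ β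

end OrientedMetricRibbonGraph

/-! Uniqueness. An arc of an admissible multi-curve turns around a single corner: otherwise a
genuine vertex would be cut out on each side of it (`turn_adjacent`). Hence signs pass to the cut
surface, and the two sides of a curve have opposite signs. Since every curve borders `c₀`, and `c₀`
meets curves only along negative boundaries, `c₀` lies on exactly one side of each curve, prescribed
by the sign. So no band carries two strands (`y_le_one`), each vertex disc has one central region,
which lies in `c₀` exactly at `v`, and the corner around which a strand turns is forced
(`turn_eq_corner`): a positive one away from `v`, a negative one at `v`. The curves thus run along
cycles of the permutation `follow`. A cycle that stays at `v`, or avoids it, runs along a boundary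
and is excluded by essentiality. A cycle that does neither must carry a curve, since otherwise its
bands would join `v` to another vertex inside `c₀`. This determines the multi-curve
(`y_and_turn_of_separates`).

Existence. These cycles do form a multi-curve (`separatingMultiCurve`). The set `PositiveStrip` is
stable under both permutations of the cut graph, so the component of `v` contains no other vertex;
following a curve until it reaches `v` shows that its positive side lies in that component
(`component_eq_of_crossed`). -/

theorem Equiv.Perm.SameCycle.apply_eq_of_invariant {α β : Type*} {g : Equiv.Perm α} {h : α → β}
    (hg : ∀ x, h (g x) = h x) {a b : α} (hab : g.SameCycle a b) : h a = h b := by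
  obtain ⟨n, rfl⟩ := hab
  induction n with
  | zero => rfl
  | succ k ih => rw [add_comm, zpow_one_add, Equiv.Perm.mul_apply, hg, ih]
  | pred k ih =>
    rw [ih, ← hg ((g ^ (-(k : ℤ) - 1)) a), ← Equiv.Perm.mul_apply, ← zpow_one_add]
    congr 3
    ring

/-! ### Orbits, components and degrees of a ribbon graph -/

namespace RibbonGraph

variable {X : Type*} (R : RibbonGraph X)

theorem vertex_eq_iff {a b : X} : R.vertex a = R.vertex b ↔ R.s0.SameCycle a b := Quotient.eq

theorem vertex_s0 (a : X) : R.vertex (R.s0 a) = R.vertex a := R.vertex_eq_iff.2 ⟨-1, by simp⟩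

theorem vertex_s0_inv (a : X) : R.vertex (R.s0⁻¹ a) = R.vertex a := R.vertex_eq_iff.2 ⟨1, by simp⟩

theorem boundary_eq_iff {a b : X} : R.boundary a = R.boundary b ↔ R.s2.SameCycle a b := Quotient.eq

theorem component_s0 (a : X) : R.component (R.s0 a) = R.component a :=
  R.component_zpow_eq R.s0_mem ⟨-1, by simp⟩

theorem component_s1 (a : X) : R.component (R.s1 a) = R.component a :=
  R.component_zpow_eq (g := R.s1) (Subgroup.subset_closure (by simp)) ⟨-1, by simp⟩

theorem component_eq_of_vertex_eq {a b : X} (h : R.vertex a = R.vertex b) :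
    R.component a = R.component b :=
  R.component_zpow_eq R.s0_mem (R.vertex_eq_iff.1 h)

/-- Invariance under the two generators extends to the group they generate. This is the tool for
showing that two half-edges lie in different components. -/
theorem mem_iff_of_component_eq {P : X → Prop} (h0 : ∀ a, P (R.s0 a) ↔ P a)
    (h1 : ∀ a, P (R.s1 a) ↔ P a) {a b : X} (h : R.component a = R.component b) : P a ↔ P b := by
  obtain ⟨⟨g, hg⟩, rfl⟩ : ∃ g : Subgroup.closure {R.s0, R.s1}, g • b = a := Quotient.exact h
  change P (g b) ↔ P b
  clear h
  induction hg using Subgroup.closure_induction generalizing b with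
  | mem x hx =>
    rcases hx with rfl | rfl
    · exact h0 b
    · exact h1 b
  | one => rfl
  | mul x y _ _ hx hy => rw [Equiv.Perm.mul_apply, hx, hy]
  | inv x _ hx => rw [← hx, ← Equiv.Perm.mul_apply, mul_inv_cancel, Equiv.Perm.one_apply]

/-- With `three_le_degree`, this reduces being a genuine vertex of a cut graph to one test: whether
the square of the rotation moves a half-edge. The converse bound needs finiteness, as `ncard` is
zero on infinite sets. -/
theorem degree_le_two {a : X} (h : R.s0 (R.s0 a) = a) : R.degree (R.vertex a) ≤ 2 := by
  have key : {e : X | R.vertex e = R.vertex a} ⊆ {a, R.s0 a} := by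
    intro e he
    have h' : ∀ x, (R.s0 x ∈ ({a, R.s0 a} : Set X)) = (x ∈ ({a, R.s0 a} : Set X)) := by
      intro x
      have h2 : R.s0 x = a ↔ x = R.s0 a := by
        rw [← R.s0.injective.eq_iff (a := x), h]
      simp only [Set.mem_insert_iff, Set.mem_singleton_iff, h2, R.s0.injective.eq_iff, or_comm]
    have := Equiv.Perm.SameCycle.apply_eq_of_invariant
      (h := fun x => x ∈ ({a, R.s0 a} : Set X)) h' (R.vertex_eq_iff.1 he)
    exact this.mpr (by simp)
  exact (Set.ncard_le_ncard key (Set.toFinite _)).trans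
    ((Set.ncard_insert_le _ _).trans (by simp))

theorem three_le_degree [Finite X] {a : X} (h : R.s0 (R.s0 a) ≠ a) :
    3 ≤ R.degree (R.vertex a) := by
  have h1 : R.s0 a ≠ a := fun h' => h (by rw [h', h'])
  have h2 : R.s0 (R.s0 a) ≠ R.s0 a := fun h' => h1 (R.s0.injective h')
  have h3 : ({a, R.s0 a, R.s0 (R.s0 a)} : Set X).ncard = 3 := by
    rw [Set.ncard_eq_three]
    exact ⟨_, _, _, h1.symm, h.symm, h2.symm, rfl⟩
  rw [← h3]
  refine Set.ncard_le_ncard ?_ (Set.toFinite _)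
  rintro x (rfl | rfl | rfl) <;> simp [vertex_s0]

theorem s0_inv_eq_iff {a b : X} : R.s0⁻¹ a = b ↔ a = R.s0 b := Equiv.Perm.inv_eq_iff_eq

/-! ### Arcs of an admissible multi-curve turn around one corner -/

namespace MultiCurve

variable {R} (Γ : R.MultiCurve)

instance [Finite X] : Finite Γ.Strip :=
  Finite.of_injective (β := Σ e : X, Fin (Γ.y e + 1))
    (fun a => ⟨a.1.1, a.1.2, Nat.lt_succ_of_le a.2⟩) (by
    rintro ⟨⟨e, i⟩, hi⟩ ⟨⟨f, j⟩, hj⟩ h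
    simp only [Sigma.mk.injEq] at h
    obtain ⟨rfl, h⟩ := h
    simpa using h)

theorem cutS0_of_lt {e : X} {i : ℕ} (h : i < Γ.y e) :
    Γ.cutS0 ⟨(e, i), h.le⟩ = ⟨((Γ.turn (e, i)).1, (Γ.turn (e, i)).2 + 1), Γ.turn_lt _ h⟩ :=
  dif_pos h

theorem cutS0_y (e : X) : Γ.cutS0 ⟨(e, Γ.y e), le_rfl⟩ = ⟨(R.s0 e, 0), Nat.zero_le _⟩ :=
  dif_neg (lt_irrefl _)

theorem cutS0_turn {p : X × ℕ} (h : p.2 < Γ.y p.1) :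
    Γ.cutS0 ⟨Γ.turn p, (Γ.turn_lt p h).le⟩ = ⟨(p.1, p.2 + 1), h⟩ := by
  rw [Γ.cutS0_of_lt (Γ.turn_lt p h)]
  simp [Γ.turn_turn]

/-- Entering a new band resets the position to `0`, so a positive position is reached only from
inside the same band. -/
theorem clockwise_eq_succ {y : X → ℕ} {a : X × ℕ} {f : X} {j : ℕ}
    (h : R.clockwise y a = (f, j + 1)) : a = (f, j) := by
  unfold clockwise at h
  split_ifs at h <;> simp_all [Prod.ext_iff]

theorem inArc_clockwise {y : X → ℕ} {p r q : X × ℕ} (h : R.InArc y p r q) :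
    R.clockwise y q = r ∨ R.InArc y p r (R.clockwise y q) := by
  obtain ⟨k, rfl, hk⟩ := h
  refine or_iff_not_imp_left.2 fun hr => ⟨k + 1, Function.iterate_succ_apply' _ _ _, ?_⟩
  intro l hl
  rcases hl.lt_or_eq with hl | rfl
  · exact hk l (by omega)
  · rwa [Function.iterate_succ_apply']

/-- The strips of a vertex disc that lie clockwise after `p` and before `turn p`. -/
def ArcStrip (p : X × ℕ) (a : Γ.Strip) : Prop :=
  R.InArc Γ.y p (Γ.turn p) a.1 ∨ a.1 = Γ.turn p

/-- The arc at `p` separates the disc: a region on one side either follows another arc, which stays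
on that side by `noncrossing`, or passes a corner, or follows the arc at `p` back to the strip just
after `p`. The pair `turn p` is the end of the arc as a strand, but as a strip it still precedes
that strand; hence the second alternative in `ArcStrip`. -/
theorem arcStrip_cutS0 {p : X × ℕ} (hp : p.2 < Γ.y p.1) {a : Γ.Strip} (h : Γ.ArcStrip p a) :
    Γ.ArcStrip p (Γ.cutS0 a) := by
  obtain ⟨⟨e, i⟩, hi⟩ := a
  have hi' : i ≤ Γ.y e := hi
  rcases h with h | h
  · by_cases hlt : i < Γ.y e
    · have h1 := inArc_clockwise (Γ.noncrossing p (e, i) hp hlt h)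
      rw [clockwise, if_pos (Γ.turn_lt _ hlt)] at h1
      rw [Γ.cutS0_of_lt hlt]
      exact h1.symm
    · obtain rfl : i = Γ.y e := by omega
      have h1 := inArc_clockwise h
      rw [clockwise, if_neg hlt] at h1
      rw [Γ.cutS0_y]
      exact h1.symm
  · have : (⟨(e, i), hi⟩ : Γ.Strip) = ⟨Γ.turn p, (Γ.turn_lt p hp).le⟩ := Subtype.ext h
    rw [this, Γ.cutS0_turn hp]
    refine Or.inl ⟨0, rfl, fun l hl => ?_⟩
    obtain rfl : l = 0 := by omega
    intro h2
    exact Γ.turn_reduced p hp (congrArg Prod.fst h2).symm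

theorem arcStrip_of_vertex_eq [Finite X] {p : X × ℕ} (hp : p.2 < Γ.y p.1) {a b : Γ.Strip}
    (h : Γ.ArcStrip p a) (hab : Γ.cut.vertex a = Γ.cut.vertex b) : Γ.ArcStrip p b := by
  obtain ⟨n, -, rfl⟩ := (Γ.cut.vertex_eq_iff.1 hab).exists_pow_eq'
  clear hab
  induction n with
  | zero => exact h
  | succ n ih => rw [pow_succ']; exact Γ.arcStrip_cutS0 hp ih

/-- A clockwise walk that starts in another band enters the band of `f` at position `0`, and so
meets `(f, i)` no later than `(f, j)`. -/
theorem not_inArc_of_le {p : X × ℕ} {f : X} (hf : p.1 ≠ f) {i j : ℕ} (hij : i ≤ j) :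
    ¬ R.InArc Γ.y p (f, i) (f, j) := by
  induction j, hij using Nat.le_induction with
  | base => rintro ⟨k, hk, h⟩; exact h k le_rfl hk
  | succ j _ ih =>
    rintro ⟨k, hk, h⟩
    cases k with
    | zero => exact hf (congrArg Prod.fst hk)
    | succ k =>
      rw [Function.iterate_succ_apply'] at hk
      exact ih ⟨k, clockwise_eq_succ hk, fun l hl => h l (by omega)⟩

/-- Beyond the last arc from `e` to `f`, where `f` does not follow `e`, there is a genuine vertex. -/
theorem exists_isVertex_of_turn [Finite X] {e f : X} (hf : f ≠ R.s0 e)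
    {i : ℕ} (hi : i < Γ.y e) (h : (Γ.turn (e, i)).1 = f) :
    ∃ (j : ℕ) (hj : j < Γ.y e), i ≤ j ∧ (Γ.turn (e, j)).1 = f ∧
      Γ.IsVertex (Γ.cut.vertex ⟨(e, j + 1), hj⟩) := by
  classical
  let s := (Finset.range (Γ.y e)).filter fun j => (Γ.turn (e, j)).1 = f
  have hs : i ∈ s := by simp [s, hi, h]
  obtain ⟨hm1, hm2⟩ : s.max' ⟨i, hs⟩ < Γ.y e ∧ (Γ.turn (e, s.max' ⟨i, hs⟩)).1 = f := by
    have := s.max'_mem ⟨i, hs⟩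
    simpa [s] using this
  have hmax : ∀ j, j < Γ.y e → (Γ.turn (e, j)).1 = f → j ≤ s.max' ⟨i, hs⟩ := fun j h1 h2 =>
    s.le_max' j (by simp [s, h1, h2])
  refine ⟨s.max' ⟨i, hs⟩, hm1, hmax i hi h, hm2, Γ.cut.three_le_degree fun hc => ?_⟩
  generalize s.max' ⟨i, hs⟩ = m at *
  -- If the region beyond the last arc to `f` were a bigon, its next side would be either another
  -- arc from `e` to `f`, against maximality, or the corner after `e`, which would give `f = s0 e`.
  have h1 : Γ.cutS0 ⟨(e, m + 1), hm1⟩ = ⟨Γ.turn (e, m), (Γ.turn_lt (e, m) hm1).le⟩ :=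
    Γ.cutS0.injective (hc.trans (Γ.cutS0_turn (p := (e, m)) hm1).symm)
  rcases (Nat.succ_le_of_lt hm1).lt_or_eq with h2 | h2
  · rw [Γ.cutS0_of_lt h2] at h1
    have h3 := congrArg (fun a : Γ.Strip => a.1.1) h1
    have := hmax _ h2 (h3.trans hm2)
    omega
  · have h3 : (⟨(e, m + 1), hm1⟩ : Γ.Strip) = ⟨(e, Γ.y e), le_rfl⟩ := Subtype.ext (by simp [← h2])
    rw [h3, Γ.cutS0_y] at h1
    exact hf (hm2.symm.trans (congrArg (fun a : Γ.Strip => a.1.1) h1).symm)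

/-- The arcs of an admissible multi-curve go around a corner of a vertex disc. -/
theorem Admissible.turn_adjacent [Finite X] {Γ : R.MultiCurve} (hΓ : Γ.Admissible) {p : X × ℕ}
    (hp : p.2 < Γ.y p.1) : (Γ.turn p).1 = R.s0 p.1 ∨ (Γ.turn p).1 = R.s0⁻¹ p.1 := by
  obtain ⟨e, i⟩ := p
  by_contra! hcon
  obtain ⟨h1, h2⟩ := hcon
  -- There is a genuine vertex beyond the last arc on either side, seen from each of the two bands.
  -- Admissibility identifies them, although the arc `(e, m)` separates them.
  obtain ⟨m, hm, -, hm1, hm2⟩ := Γ.exists_isVertex_of_turn h1 hp rfl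
  have h3 : e ≠ R.s0 (Γ.turn (e, i)).1 := fun h => h2 (R.s0_inv_eq_iff.2 h).symm
  have hlt := Γ.turn_lt (e, m) hm
  obtain ⟨n, hn, hmn, hn1, hn2⟩ := Γ.exists_isVertex_of_turn (e := (Γ.turn (e, i)).1)
    (i := (Γ.turn (e, m)).2) h3 (by rw [← hm1]; exact hlt) (by rw [← hm1, Prod.mk.eta, Γ.turn_turn])
  have heq := hΓ _ _ hm2 hn2 (Γ.turn_vertex (e, i)).symm
  have h4 : Γ.ArcStrip (e, m) ⟨(e, m + 1), hm⟩ := by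
    have := Γ.arcStrip_cutS0 (p := (e, m)) hm (a := ⟨Γ.turn (e, m), hlt.le⟩) (Or.inr rfl)
    rwa [Γ.cutS0_turn hm] at this
  have hne : e ≠ (Γ.turn (e, i)).1 := (Γ.turn_reduced (e, i) hp).symm
  have heta : Γ.turn (e, m) = ((Γ.turn (e, i)).1, (Γ.turn (e, m)).2) := Prod.ext hm1 rfl
  rcases Γ.arcStrip_of_vertex_eq hm h4 heq with h5 | h5
  · rw [heta] at h5
    exact Γ.not_inArc_of_le hne (by omega) h5
  · rw [heta, Prod.ext_iff] at h5
    simp only at h5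
    omega

end MultiCurve

end RibbonGraph

/-! ### Central regions when each band carries at most one strand -/

namespace RibbonGraph

variable {X : Type*} {R : RibbonGraph X}

theorem s0_s0_ne (h : ∀ v, 3 ≤ R.degree v) (e : X) : R.s0 (R.s0 e) ≠ e := fun he => by
  have := h (R.vertex e)
  have := R.degree_le_two he
  omega

theorem s0_ne_s0_inv (h : ∀ v, 3 ≤ R.degree v) (e : X) : R.s0 e ≠ R.s0⁻¹ e := fun he =>
  s0_s0_ne h e (R.s0_inv_eq_iff.1 he.symm).symm

namespace MultiCurve

variable (Γ : R.MultiCurve)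

/-- Every arc goes around a corner of a vertex disc. -/
def TurnsAtCorners : Prop :=
  ∀ p, p.2 < Γ.y p.1 → (Γ.turn p).1 = R.s0 p.1 ∨ (Γ.turn p).1 = R.s0⁻¹ p.1

theorem y_turn_zero (hy : ∀ e, Γ.y e ≤ 1) {e : X} (he : Γ.y e = 1) :
    Γ.y (Γ.turn (e, 0)).1 = 1 ∧ Γ.turn (e, 0) = ((Γ.turn (e, 0)).1, 0) := by
  have h1 := Γ.turn_lt (e, 0) (by simp [he])
  have h2 := hy (Γ.turn (e, 0)).1
  exact ⟨by omega, Prod.ext rfl (show (Γ.turn (e, 0)).2 = 0 by omega)⟩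

open Classical in
/-- The strip of the band of `f` that reaches the middle of the vertex disc, if every band is crossed
by at most one strand and the arcs go around the corners. -/
noncomputable def center (f : X) : Γ.Strip :=
  -- An arc to `s0⁻¹ f` cuts off the corner before `f`, hence strip `0`; in the other cases strip
  -- `0` reaches the middle.
  if h : Γ.y f = 1 ∧ (Γ.turn (f, 0)).1 = R.s0⁻¹ f then ⟨(f, 1), h.1.ge⟩ else ⟨(f, 0), Nat.zero_le _⟩

theorem center_fst (f : X) : (Γ.center f).1.1 = f := by
  unfold center
  split_ifs <;> rfl

theorem center_of_y_eq_zero {f : X} (h : Γ.y f = 0) : Γ.center f = ⟨(f, 0), Nat.zero_le _⟩ :=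
  dif_neg (by simp [h])

theorem center_of_turn_eq {f : X} (h : Γ.y f = 1) (hf : (Γ.turn (f, 0)).1 = R.s0⁻¹ f) :
    Γ.center f = ⟨(f, 1), h.ge⟩ :=
  dif_pos ⟨h, hf⟩

theorem center_of_turn_ne {f : X} (hf : (Γ.turn (f, 0)).1 ≠ R.s0⁻¹ f) :
    Γ.center f = ⟨(f, 0), Nat.zero_le _⟩ :=
  dif_neg fun h => hf h.2

theorem center_injective : Function.Injective Γ.center := fun f g h => by
  rw [← Γ.center_fst f, h, Γ.center_fst]

theorem baseVertex_center (f : X) : Γ.baseVertex (Γ.cut.vertex (Γ.center f)) = R.vertex f :=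
  congrArg R.vertex (Γ.center_fst f)

theorem cutS0_last {e : X} {i : ℕ} (h : i = Γ.y e) :
    Γ.cutS0 ⟨(e, i), h.le⟩ = ⟨(R.s0 e, 0), Nat.zero_le _⟩ := by
  subst h
  exact Γ.cutS0_y e

theorem cutS0_zero (hy : ∀ e, Γ.y e ≤ 1) {e : X} (h : Γ.y e = 1) :
    Γ.cutS0 ⟨(e, 0), Nat.zero_le _⟩ = ⟨((Γ.turn (e, 0)).1, 1), (Γ.y_turn_zero hy h).1.ge⟩ := by
  rw [Γ.cutS0_of_lt (by omega)]
  exact Subtype.ext (Prod.ext rfl (by simp [congrArg Prod.snd (Γ.y_turn_zero hy h).2]))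

variable {Γ}

/-- The central region goes around the disc as the original vertex does: between consecutive bands
it either passes their corner or follows the arc that cuts this corner off. -/
theorem cutS0_center (hdeg : ∀ v, 3 ≤ R.degree v) (hy : ∀ e, Γ.y e ≤ 1) (hΓ : Γ.TurnsAtCorners)
    (f : X) : Γ.cutS0 (Γ.center f) = Γ.center (R.s0 f) := by
  by_cases h : (Γ.y f = 1 ∧ (Γ.turn (f, 0)).1 = R.s0⁻¹ f) ∨ Γ.y f = 0
  · have h1 : Γ.cutS0 (Γ.center f) = ⟨(R.s0 f, 0), Nat.zero_le _⟩ := by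
      rcases h with ⟨h, h'⟩ | h
      · rw [Γ.center_of_turn_eq h h', Γ.cutS0_last h.symm]
      · rw [Γ.center_of_y_eq_zero h, Γ.cutS0_last h.symm]
    rw [h1, center, dif_neg]
    rintro ⟨h2, h3⟩
    rw [← Equiv.Perm.mul_apply, inv_mul_cancel, Equiv.Perm.one_apply] at h3
    have h4 := Γ.y_turn_zero hy h2
    have h5 := Γ.turn_turn (R.s0 f, 0)
    rw [h3] at h4
    rw [h4.2] at h5
    rcases h with ⟨-, h⟩ | h
    · rw [h5] at h
      exact s0_ne_s0_inv hdeg f h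
    · omega
  · have hf : Γ.y f = 1 := by have := hy f; omega
    have h2 : (Γ.turn (f, 0)).1 ≠ R.s0⁻¹ f := fun h' => h (Or.inl ⟨hf, h'⟩)
    have h3 := (hΓ (f, 0) (by simp [hf])).resolve_right h2
    have h4 := Γ.y_turn_zero hy hf
    have h5 := Γ.turn_turn (f, 0)
    rw [h4.2, h3] at h5
    simp only [h3] at h4
    rw [Γ.center_of_turn_ne h2, Γ.cutS0_zero hy hf,
      Γ.center_of_turn_eq h4.1 (by rw [h5, ← Equiv.Perm.mul_apply, inv_mul_cancel]; rfl)]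
    simp [h3]

/-- A strip that is not central lies in the bigon between an arc and the corner it cuts off. -/
theorem cutS0_cutS0_of_ne_center (hy : ∀ e, Γ.y e ≤ 1) (hΓ : Γ.TurnsAtCorners) {a : Γ.Strip}
    (ha : a ≠ Γ.center a.1.1) : Γ.cutS0 (Γ.cutS0 a) = a := by
  obtain ⟨⟨f, i⟩, hi⟩ := a
  have hi' : i ≤ Γ.y f := hi
  have hyf := hy f
  have hf : Γ.y f = 1 := by
    by_contra h
    have h0 : Γ.y f = 0 := by omega
    obtain rfl : i = 0 := by omega
    exact ha (Γ.center_of_y_eq_zero h0).symm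
  have h4 := Γ.y_turn_zero hy hf
  have h5 := Γ.turn_turn (f, 0)
  by_cases h : (Γ.turn (f, 0)).1 = R.s0⁻¹ f
  · obtain rfl : i = 0 := by
      by_contra h0
      obtain rfl : i = 1 := by omega
      exact ha (Γ.center_of_turn_eq hf h).symm
    rw [Γ.cutS0_zero hy hf, Γ.cutS0_last h4.1.symm]
    simp only [h]
    exact Subtype.ext (Prod.ext (R.s0.apply_symm_apply f) rfl)
  · obtain rfl : i = 1 := by
      by_contra h0
      obtain rfl : i = 0 := by omega
      exact ha (Γ.center_of_turn_ne h).symm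
    have h3 := (hΓ (f, 0) (by simp [hf])).resolve_right h
    rw [h4.2, h3] at h5
    rw [h3] at h4
    rw [Γ.cutS0_last hf.symm, Γ.cutS0_zero hy h4.1]
    exact Subtype.ext (by simp only [h5])

theorem vertex_center_eq (hdeg : ∀ v, 3 ≤ R.degree v) (hy : ∀ e, Γ.y e ≤ 1)
    (hΓ : Γ.TurnsAtCorners) {f g : X} (h : R.vertex f = R.vertex g) :
    Γ.cut.vertex (Γ.center f) = Γ.cut.vertex (Γ.center g) :=
  (R.vertex_eq_iff.1 h).apply_eq_of_invariant (h := fun f => Γ.cut.vertex (Γ.center f)) fun f => by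
    rw [← cutS0_center hdeg hy hΓ]
    exact Γ.cut.vertex_s0 _

theorem isVertex_center [Finite X] (hdeg : ∀ v, 3 ≤ R.degree v) (hy : ∀ e, Γ.y e ≤ 1)
    (hΓ : Γ.TurnsAtCorners) (f : X) : Γ.IsVertex (Γ.cut.vertex (Γ.center f)) := by
  refine Γ.cut.three_le_degree ?_
  change Γ.cutS0 (Γ.cutS0 _) ≠ _
  rw [cutS0_center hdeg hy hΓ, cutS0_center hdeg hy hΓ]
  exact fun h => s0_s0_ne hdeg f (Γ.center_injective h)

theorem exists_center_of_isVertex (hy : ∀ e, Γ.y e ≤ 1) (hΓ : Γ.TurnsAtCorners)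
    {w : Γ.cut.Vertex} (hw : Γ.IsVertex w) : ∃ f, w = Γ.cut.vertex (Γ.center f) := by
  induction w using Quotient.inductionOn with
  | _ a =>
  refine ⟨a.1.1, ?_⟩
  by_contra hne
  have ha : a ≠ Γ.center a.1.1 := fun h => hne (congrArg Γ.cut.vertex h)
  have h1 := Γ.cut.degree_le_two (cutS0_cutS0_of_ne_center hy hΓ ha)
  have h2 : 3 ≤ Γ.cut.degree (Γ.cut.vertex a) := hw
  omega

theorem admissible_of_turnsAtCorners (hdeg : ∀ v, 3 ≤ R.degree v) (hy : ∀ e, Γ.y e ≤ 1)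
    (hΓ : Γ.TurnsAtCorners) : Γ.Admissible := by
  intro w w' hw hw' h
  obtain ⟨f, rfl⟩ := exists_center_of_isVertex hy hΓ hw
  obtain ⟨g, rfl⟩ := exists_center_of_isVertex hy hΓ hw'
  exact vertex_center_eq hdeg hy hΓ (by simpa [baseVertex_center] using h)

theorem component_center_eq (hdeg : ∀ v, 3 ≤ R.degree v) (hy : ∀ e, Γ.y e ≤ 1)
    (hΓ : Γ.TurnsAtCorners) {f g : X} (h : R.vertex f = R.vertex g) :
    Γ.cut.component (Γ.center f) = Γ.cut.component (Γ.center g) :=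
  Γ.cut.component_eq_of_vertex_eq (vertex_center_eq hdeg hy hΓ h)

theorem component_cutS0 (a : Γ.Strip) : Γ.cut.component (Γ.cutS0 a) = Γ.cut.component a :=
  Γ.cut.component_s0 a

theorem component_cutS1 (a : Γ.Strip) : Γ.cut.component (Γ.cutS1 a) = Γ.cut.component a :=
  Γ.cut.component_s1 a

theorem flip_succ {e : X} {i : ℕ} (h : i + 1 ≤ Γ.y e) :
    Γ.flip ⟨(e, i + 1), h⟩ = Γ.cutS1 ⟨(e, i), (Nat.le_succ i).trans h⟩ :=
  if_neg (Nat.succ_ne_zero i)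

theorem snd_ne_zero_of_glue_ne {a : Γ.Strip}
    (h : Γ.glue (Γ.cut.boundary a) ≠ Γ.cut.boundary a) : a.1.2 ≠ 0 := fun h0 =>
  h (congrArg Γ.cut.boundary (if_pos h0 : Γ.flip a = a))

end MultiCurve

end RibbonGraph

/-! ### Signs, corners and the permutation followed by the curves -/

namespace OrientedMetricRibbonGraph

variable {X : Type*} (S : OrientedMetricRibbonGraph X)

theorem ε_s0 (e : X) : S.ε (S.s0 e) = -S.ε e := by
  have h : S.s2 (S.s0 e) = S.s1 e := congrArg S.s1 (S.s0.symm_apply_apply e)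
  rw [← S.ε_s2, h, S.ε_s1]

theorem ε_s0_inv (e : X) : S.ε (S.s0⁻¹ e) = -S.ε e := by
  have h := S.ε_s0 (S.s0⁻¹ e)
  rw [← Equiv.Perm.mul_apply, mul_inv_cancel, Equiv.Perm.one_apply] at h
  rw [h, neg_neg]

theorem ε_eq_neg_one_iff (e : X) : S.ε e = -1 ↔ S.ε e ≠ 1 := by
  rcases Int.units_eq_one_or (S.ε e) with h | h <;> rw [h] <;> decide

theorem neg_ε_eq_one_iff (e : X) : -S.ε e = 1 ↔ S.ε e ≠ 1 := by
  rcases Int.units_eq_one_or (S.ε e) with h | h <;> rw [h] <;> decide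

section Corner

variable (v : S.Vertex)

open Classical in
/-- The half-edge next to `e` across a positive corner, or across a negative corner at the
vertex `v`. -/
noncomputable def corner (e : X) : X :=
  -- The corner between `e` and `s0 e` lies on the boundary of `s0 e`, whose sign is `-ε e`.
  if S.vertex e = v ↔ S.ε e = 1 then S.s0 e else S.s0⁻¹ e

variable {v} in
theorem corner_of_iff {e : X} (h : S.vertex e = v ↔ S.ε e = 1) : S.corner v e = S.s0 e := if_pos h

variable {v} in
theorem corner_of_not_iff {e : X} (h : ¬(S.vertex e = v ↔ S.ε e = 1)) :
    S.corner v e = S.s0⁻¹ e := if_neg h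

theorem corner_eq_or (e : X) : S.corner v e = S.s0 e ∨ S.corner v e = S.s0⁻¹ e := by
  unfold corner
  split_ifs <;> simp

theorem vertex_corner (e : X) : S.vertex (S.corner v e) = S.vertex e := by
  rcases S.corner_eq_or v e with h | h <;> rw [h]
  · exact S.vertex_s0 e
  · exact S.vertex_s0_inv e

theorem ε_corner (e : X) : S.ε (S.corner v e) = -S.ε e := by
  rcases S.corner_eq_or v e with h | h <;> rw [h]
  · exact S.ε_s0 e
  · exact S.ε_s0_inv e

/-- Turning around a corner keeps the vertex and changes the sign, so the test defining `corner`
changes its answer and the second rotation undoes the first. -/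
theorem corner_corner (e : X) : S.corner v (S.corner v e) = e := by
  have h1 := S.vertex_corner v e
  have h2 := S.ε_corner v e
  by_cases h : S.vertex e = v ↔ S.ε e = 1
  · rw [S.corner_of_not_iff (e := S.corner v e), S.corner_of_iff h, ← Equiv.Perm.mul_apply,
      inv_mul_cancel, Equiv.Perm.one_apply]
    rw [h1, h2, neg_ε_eq_one_iff]
    tauto
  · rw [S.corner_of_iff (e := S.corner v e), S.corner_of_not_iff h, ← Equiv.Perm.mul_apply,
      mul_inv_cancel, Equiv.Perm.one_apply]
    rw [h1, h2, neg_ε_eq_one_iff]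
    tauto

/-- Cross the edge `e` and turn around the corner at its end. -/
noncomputable def follow : Equiv.Perm X :=
  (Function.Involutive.toPerm (S.corner v) (S.corner_corner v)) * S.s1

theorem follow_apply (e : X) : S.follow v e = S.corner v (S.s1 e) := rfl

theorem ε_follow (e : X) : S.ε (S.follow v e) = S.ε e := by
  rw [follow_apply, ε_corner, S.ε_s1, neg_neg]

theorem sameCycle_follow (e : X) : (S.follow v).SameCycle e (S.follow v e) := ⟨1, by simp⟩

/-- Reversing a curve. -/
theorem sameCycle_corner {e f : X} (h : (S.follow v).SameCycle (S.s1 e) f) :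
    (S.follow v).SameCycle e (S.corner v f) := by
  obtain ⟨n, rfl⟩ := h
  -- Reversal turns `follow` into its inverse; the shift by one appears because `corner` after `s1`
  -- is already one step of `follow`.
  have key : ∀ (n : ℤ) (e : X),
      S.corner v (((S.follow v) ^ n) (S.s1 e)) = ((S.follow v) ^ (1 - n)) e := by
    intro n
    induction n with
    | zero => intro e; simp [follow_apply]
    | succ k ih =>
      intro e
      have h1 : S.follow v (S.s1 e) = S.s1 (S.s1 (S.corner v e)) := by
        rw [follow_apply, S.s1_s1, S.s1_s1]
      have h2 : S.follow v (S.s1 (S.corner v e)) = e := by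
        rw [follow_apply, S.s1_s1, corner_corner]
      rw [zpow_add_one, Equiv.Perm.mul_apply, h1, ih,
        show (1 - k : ℤ) = 1 - (k + 1) + 1 by ring, zpow_add_one, Equiv.Perm.mul_apply, h2]
    | pred k ih =>
      intro e
      have h1 : (S.follow v)⁻¹ (S.s1 e) = S.s1 (S.follow v e) := by
        rw [Equiv.Perm.inv_eq_iff_eq, follow_apply S v (S.s1 _), S.s1_s1, follow_apply,
          corner_corner]
      rw [zpow_sub_one, Equiv.Perm.mul_apply, h1, ih, ← Equiv.Perm.mul_apply, ← zpow_add_one]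
      congr 2
      ring
  exact ⟨1 - n, (key n e).symm⟩

/-- The curve that follows `e` visits the vertex `v` and also another vertex. -/
def Crossed (e : X) : Prop :=
  (∃ f, (S.follow v).SameCycle e f ∧ S.vertex f = v) ∧
    ∃ f, (S.follow v).SameCycle e f ∧ S.vertex f ≠ v

variable {v}

theorem Crossed.of_s1 {e : X} (h : S.Crossed v (S.s1 e)) : S.Crossed v e := by
  obtain ⟨⟨f, hf, hf'⟩, g, hg, hg'⟩ := h
  exact ⟨⟨_, S.sameCycle_corner v hf, by rwa [vertex_corner]⟩,
    _, S.sameCycle_corner v hg, by rwa [vertex_corner]⟩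

theorem crossed_s1 {e : X} : S.Crossed v (S.s1 e) ↔ S.Crossed v e :=
  ⟨Crossed.of_s1 S, fun h => Crossed.of_s1 S (by rwa [S.s1_s1])⟩

theorem Crossed.of_sameCycle {e e' : X} (h : S.Crossed v e)
    (he : (S.follow v).SameCycle e' e) : S.Crossed v e' := by
  obtain ⟨⟨f, hf, hf'⟩, g, hg, hg'⟩ := h
  exact ⟨⟨f, he.trans hf, hf'⟩, g, he.trans hg, hg'⟩

theorem crossed_follow {e : X} : S.Crossed v (S.follow v e) ↔ S.Crossed v e :=
  ⟨fun h => Crossed.of_sameCycle S h (S.sameCycle_follow v e),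
    fun h => Crossed.of_sameCycle S h (S.sameCycle_follow v e).symm⟩

theorem crossed_corner {e : X} : S.Crossed v (S.corner v e) ↔ S.Crossed v e := by
  rw [← S.crossed_s1 (e := e), ← S.crossed_follow (e := S.s1 e), follow_apply, S.s1_s1]

/-- Away from the vertex `v` the curves follow the positive boundaries, and at `v` they follow the
negative ones. -/
theorem s2_follow_eq_iff (hdeg : ∀ v, 3 ≤ S.degree v) (e : X) :
    S.s2 (S.follow v e) = e ↔ (S.vertex (S.follow v e) = v ↔ S.ε (S.s1 e) = 1) := by
  have h1 : S.s2 (S.follow v e) = e ↔ S.corner v (S.s1 e) = S.s0 (S.s1 e) := by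
    change S.s1 (S.s0⁻¹ (S.follow v e)) = e ↔ _
    rw [← S.s1.injective.eq_iff, S.s1_s1, S.s0_inv_eq_iff, follow_apply]
  rw [h1, follow_apply, vertex_corner]
  refine ⟨fun h => ?_, S.corner_of_iff⟩
  by_contra hn
  rw [S.corner_of_not_iff hn] at h
  exact RibbonGraph.s0_ne_s0_inv hdeg _ h.symm

end Corner

end OrientedMetricRibbonGraph

/-! ### Uniqueness: the strands and their turns are forced -/

namespace OrientedMetricRibbonGraph

open RibbonGraph MultiCurve

variable {X : Type*} (S : OrientedMetricRibbonGraph X) {Γ : S.toRibbonGraph.MultiCurve}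

theorem ε_turn (hΓ : Γ.TurnsAtCorners) {p : X × ℕ} (hp : p.2 < Γ.y p.1) :
    S.ε (Γ.turn p).1 = -S.ε p.1 := by
  rcases hΓ p hp with h | h <;> rw [h]
  · exact S.ε_s0 _
  · exact S.ε_s0_inv _

theorem ε_cutS0 (hΓ : Γ.TurnsAtCorners) (a : Γ.Strip) :
    S.ε (Γ.cutS0 a).1.1 = -S.ε a.1.1 := by
  obtain ⟨⟨e, i⟩, hi⟩ := a
  rcases (show i ≤ Γ.y e from hi).lt_or_eq with h | h
  · rw [Γ.cutS0_of_lt h]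
    exact S.ε_turn hΓ h
  · rw [Γ.cutS0_last h]
    exact S.ε_s0 e

/-- Both rotating around a region and exchanging the ends of a strip change the sign, so each
boundary of the cut surface has a well-defined sign. -/
theorem ε_cut_s2 (hΓ : Γ.TurnsAtCorners) (a : Γ.Strip) :
    S.ε (Γ.cut.s2 a).1.1 = S.ε a.1.1 := by
  obtain ⟨b, rfl⟩ := Γ.cutS0.surjective a
  have h : Γ.cut.s2 (Γ.cutS0 b) = Γ.cutS1 b := congrArg Γ.cutS1 (Γ.cutS0.symm_apply_apply b)
  rw [h, ε_cutS0 S hΓ]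
  exact S.ε_s1 _

theorem ε_eq_of_boundary_eq (hΓ : Γ.TurnsAtCorners) {a b : Γ.Strip}
    (h : Γ.cut.boundary a = Γ.cut.boundary b) : S.ε a.1.1 = S.ε b.1.1 :=
  (Γ.cut.boundary_eq_iff.1 h).apply_eq_of_invariant (h := fun a => S.ε a.1.1) (S.ε_cut_s2 hΓ)

/-- Every curve of an oriented multi-curve glues two boundaries of opposite signs. -/
theorem glue_boundary_ne (hΓ : Γ.TurnsAtCorners) {a : Γ.Strip} (ha : a.1.2 ≠ 0) :
    Γ.glue (Γ.cut.boundary a) ≠ Γ.cut.boundary a := by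
  intro h
  have h1 : S.ε (Γ.flip a).1.1 = S.ε a.1.1 := S.ε_eq_of_boundary_eq hΓ h
  rw [MultiCurve.flip, if_neg ha] at h1
  change S.ε (S.s1 a.1.1) = S.ε a.1.1 at h1
  rw [S.ε_s1] at h1
  rcases Int.units_eq_one_or (S.ε a.1.1) with h2 | h2 <;> rw [h2] at h1 <;> revert h1 <;> decide

section Component

variable {c₀ : Γ.cut.Component}

/-- The strand `(e, i)` is on the left of the strip `(e, i + 1)`, so the boundary there comes from a
curve. The companion lemma for `(e, i)` reads that strip from its other end, where the sign is
opposite. -/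
theorem ε_eq_neg_one_of_component (hΓ : Γ.TurnsAtCorners) (hneg : S.GluedAlongNegative Γ c₀)
    {e : X} {i : ℕ} (hi : i + 1 ≤ Γ.y e) (hc : Γ.cut.component ⟨(e, i + 1), hi⟩ = c₀) :
    S.ε e = -1 :=
  hneg (Γ.cut.boundary ⟨(e, i + 1), hi⟩) (S.glue_boundary_ne hΓ (Nat.succ_ne_zero i)) hc _ rfl

theorem ε_eq_one_of_component (hΓ : Γ.TurnsAtCorners) (hneg : S.GluedAlongNegative Γ c₀)
    {e : X} {i : ℕ} (hi : i < Γ.y e) (hc : Γ.cut.component ⟨(e, i), hi.le⟩ = c₀) :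
    S.ε e = 1 := by
  have h1 : Γ.y e - i - 1 + 1 ≤ Γ.y (S.s1 e) := by rw [Γ.y_s1]; omega
  have h2 : (⟨(S.s1 e, Γ.y e - i - 1 + 1), h1⟩ : Γ.Strip) = Γ.cutS1 ⟨(e, i), hi.le⟩ :=
    Subtype.ext (Prod.ext rfl (by rw [coe_cutS1]; simp only; omega))
  have h3 := S.ε_eq_neg_one_of_component hΓ hneg h1 (by rw [h2, component_cutS1, hc])
  rw [S.ε_s1] at h3
  exact neg_inj.1 h3

theorem component_or (hΓ : Γ.TurnsAtCorners) (hall : Γ.AllCurvesBound c₀)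
    {e : X} {i : ℕ} (hi : i < Γ.y e) :
    Γ.cut.component ⟨(e, i), hi.le⟩ = c₀ ∨ Γ.cut.component ⟨(e, i + 1), hi⟩ = c₀ := by
  rcases hall (Γ.cut.boundary ⟨(e, i + 1), hi⟩)
    (S.glue_boundary_ne hΓ (Nat.succ_ne_zero i)) with h | h
  · exact Or.inr h
  · refine Or.inl ?_
    change Γ.cut.component (Γ.flip _) = c₀ at h
    rwa [flip_succ, component_cutS1] at h

/-- The strip `(e, 1)` between two strands cannot lie in `c₀`, as its two sides would impose
opposite signs on `e`. Then `(e, 0)` and `(e, 2)` both lie in `c₀`, with the same contradiction. -/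
theorem y_le_one (hΓ : Γ.TurnsAtCorners) (hall : Γ.AllCurvesBound c₀)
    (hneg : S.GluedAlongNegative Γ c₀) (e : X) : Γ.y e ≤ 1 := by
  by_contra! hlt
  have h0 := S.component_or hΓ hall (e := e) (i := 0) (by omega)
  have h1 := S.component_or hΓ hall (e := e) (i := 1) (by omega)
  have h2 : S.ε e = 1 → S.ε e = -1 → False := fun h h' => absurd (h.symm.trans h') (by decide)
  rcases h1 with h1 | h1
  · exact h2 (S.ε_eq_one_of_component hΓ hneg hlt h1)
      (S.ε_eq_neg_one_of_component hΓ hneg (i := 0) hlt.le h1)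
  · have h3 := S.ε_eq_neg_one_of_component hΓ hneg hlt h1
    rcases h0 with h0 | h0
    · exact h2 (S.ε_eq_one_of_component hΓ hneg (hlt.trans' one_pos) h0) h3
    · exact h2 (S.ε_eq_one_of_component hΓ hneg hlt h0) h3

variable {v : S.Vertex}

theorem component_center_eq_iff [Finite X] (hdeg : ∀ v, 3 ≤ S.degree v) (hy : ∀ e, Γ.y e ≤ 1)
    (hΓ : Γ.TurnsAtCorners) (hsep : Γ.SeparatesVertex v c₀) (e : X) :
    Γ.cut.component (Γ.center e) = c₀ ↔ S.vertex e = v := by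
  obtain ⟨⟨w, hw, hwv, hwc⟩, hsep⟩ := hsep
  obtain ⟨f, rfl⟩ := exists_center_of_isVertex hy hΓ hw
  rw [baseVertex_center] at hwv
  constructor
  · intro h
    rw [← hsep _ (isVertex_center hdeg hy hΓ e) h, baseVertex_center]
  · intro h
    rw [component_center_eq hdeg hy hΓ (h.trans hwv.symm)]
    exact hwc

/-- The sign of `e` tells which of its two strips lies in `c₀`, and the vertex tells whether the
central one does. Together they determine which strip is central, hence which corner the arc cuts
off. -/
theorem turn_eq_corner [Finite X] (hdeg : ∀ v, 3 ≤ S.degree v) (hy : ∀ e, Γ.y e ≤ 1)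
    (hΓ : Γ.TurnsAtCorners) (hsep : Γ.SeparatesVertex v c₀) (hall : Γ.AllCurvesBound c₀)
    (hneg : S.GluedAlongNegative Γ c₀) {e : X} (he : Γ.y e = 1) :
    Γ.turn (e, 0) = (S.corner v e, 0) := by
  rw [(Γ.y_turn_zero hy he).2]
  refine Prod.ext ?_ rfl
  have hlt : 0 < Γ.y e := by omega
  have hc := S.component_center_eq_iff hdeg hy hΓ hsep e
  have h0 := S.ε_eq_one_of_component hΓ hneg hlt
  have h1 := S.ε_eq_neg_one_of_component hΓ hneg (i := 0) hlt
  have h01 := S.component_or hΓ hall hlt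
  have h2 := S.ε_eq_neg_one_iff e
  by_cases h : (Γ.turn (e, 0)).1 = S.s0⁻¹ e
  · rw [Γ.center_of_turn_eq he h] at hc
    simp only at h ⊢
    rw [h, S.corner_of_not_iff]
    rw [← hc]
    simp only [zero_add] at *
    tauto
  · have h3 := (hΓ (e, 0) hlt).resolve_right h
    rw [Γ.center_of_turn_ne h] at hc
    simp only at h3 ⊢
    rw [h3, S.corner_of_iff]
    rw [← hc]
    simp only [zero_add] at *
    tauto

theorem word_eq_follow (hy : ∀ e, Γ.y e ≤ 1)
    (hturn : ∀ e, Γ.y e = 1 → Γ.turn (e, 0) = (S.corner v e, 0)) {e : X} (he : Γ.y e = 1) (k : ℕ) :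
    Γ.y ((S.follow v ^ k) e) = 1 ∧
      (S.nextStrand Γ.y Γ.turn)^[k] (e, 0) = ((S.follow v ^ k) e, 0) := by
  induction k with
  | zero => exact ⟨he, rfl⟩
  | succ k ih =>
    have h1 : Γ.y (S.s1 ((S.follow v ^ k) e)) = 1 := (Γ.y_s1 _).trans ih.1
    have h2 := (Γ.y_turn_zero hy h1).1
    rw [hturn _ h1] at h2
    rw [pow_succ', Equiv.Perm.mul_apply, Function.iterate_succ_apply', ih.2, nextStrand,
      reverseStrand]
    exact ⟨h2, by simp only [ih.1, Nat.sub_self]; exact hturn _ h1⟩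

/-- No curve follows a boundary. -/
theorem not_forall_vertex_iff (hdeg : ∀ v, 3 ≤ S.degree v) (hy : ∀ e, Γ.y e ≤ 1)
    (hturn : ∀ e, Γ.y e = 1 → Γ.turn (e, 0) = (S.corner v e, 0)) {e : X} (he : Γ.y e = 1) :
    ¬ ∀ f, (S.follow v).SameCycle e f → (S.vertex f = v ↔ S.ε (S.s1 e) = 1) := by
  intro h
  refine Γ.essential (e, 0) (by simp [he]) fun k => ?_
  simp only [word, (S.word_eq_follow hy hturn he _).2]
  rw [pow_succ', Equiv.Perm.mul_apply, S.s2_follow_eq_iff hdeg]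
  -- The sign is constant along the curve, so the criterion `s2_follow_eq_iff` is the same condition
  -- at every step.
  have hε : ∀ k : ℕ, S.ε ((S.follow v ^ k) e) = S.ε e := by
    intro k
    exact (Equiv.Perm.SameCycle.apply_eq_of_invariant (h := S.ε) (S.ε_follow v) ⟨k, rfl⟩).symm
  rw [S.ε_s1, hε, ← S.ε_s1]
  exact h _ ⟨k + 1, by rw [← Nat.cast_succ, zpow_natCast, pow_succ', Equiv.Perm.mul_apply]⟩

/-- In its positive direction, a curve that avoids `v` would follow a positive boundary; in the
opposite direction, a curve that stays at `v` would follow a negative one. -/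
theorem crossed_of_y_eq_one (hdeg : ∀ v, 3 ≤ S.degree v) (hy : ∀ e, Γ.y e ≤ 1)
    (hturn : ∀ e, Γ.y e = 1 → Γ.turn (e, 0) = (S.corner v e, 0)) {e : X} (he : Γ.y e = 1) :
    S.Crossed v e := by
  have key : ∀ e, Γ.y e = 1 → S.ε e = 1 → S.Crossed v e := by
    intro e he hε
    have he' : Γ.y (S.s1 e) = 1 := (Γ.y_s1 e).trans he
    have h1 := S.not_forall_vertex_iff hdeg hy hturn he
    have h2 := S.not_forall_vertex_iff hdeg hy hturn he'
    rw [S.ε_s1, hε] at h1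
    rw [S.s1_s1, hε] at h2
    have h3 : (-1 : ℤˣ) ≠ 1 := by decide
    simp only [h3, iff_false, iff_true, not_forall, not_not] at h1 h2
    obtain ⟨f, hf, hf'⟩ := h1
    obtain ⟨g, hg, hg'⟩ := h2
    exact ⟨⟨f, hf, hf'⟩, _, S.sameCycle_corner v hg, by rwa [vertex_corner]⟩
  rcases Int.units_eq_one_or (S.ε e) with hε | hε
  · exact key e he hε
  · exact Crossed.of_s1 S (key _ ((Γ.y_s1 e).trans he) (by rw [S.ε_s1, hε, neg_neg]))

theorem y_corner (hy : ∀ e, Γ.y e ≤ 1)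
    (hturn : ∀ e, Γ.y e = 1 → Γ.turn (e, 0) = (S.corner v e, 0)) (e : X) :
    Γ.y (S.corner v e) = Γ.y e := by
  have key : ∀ e, Γ.y e = 1 → Γ.y (S.corner v e) = 1 := by
    intro e he
    have h := (Γ.y_turn_zero hy he).1
    rwa [hturn e he] at h
  have h1 := key e
  have h2 := key (S.corner v e)
  rw [corner_corner] at h2
  have := hy e
  have := hy (S.corner v e)
  omega

/-- A band without strands is a single strip, central at both ends, so membership in `c₀` propagates
along the cycle of `follow`; its vertices would all be `v` or all differ from `v`. -/
theorem y_eq_one_of_crossed [Finite X] (hdeg : ∀ v, 3 ≤ S.degree v) (hy : ∀ e, Γ.y e ≤ 1)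
    (hΓ : Γ.TurnsAtCorners) (hsep : Γ.SeparatesVertex v c₀)
    (hturn : ∀ e, Γ.y e = 1 → Γ.turn (e, 0) = (S.corner v e, 0)) {e : X} (he : S.Crossed v e) :
    Γ.y e = 1 := by
  by_contra hne
  have h0 : Γ.y e = 0 := by have := hy e; omega
  have hinv : ∀ x, (Γ.y (S.follow v x) = 0 ∧ Γ.cut.component (Γ.center (S.follow v x)) = c₀) =
      (Γ.y x = 0 ∧ Γ.cut.component (Γ.center x) = c₀) := by
    intro x
    have h1 : Γ.y (S.follow v x) = Γ.y x := by
      rw [follow_apply, S.y_corner hy hturn, Γ.y_s1]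
    rw [h1]
    refine propext (and_congr_right fun hx => ?_)
    have h2 : Γ.center (S.s1 x) = Γ.cutS1 (Γ.center x) := by
      rw [Γ.center_of_y_eq_zero ((Γ.y_s1 x).trans hx), Γ.center_of_y_eq_zero hx]
      exact Subtype.ext (Prod.ext rfl (by simp [coe_cutS1, hx]))
    rw [follow_apply, component_center_eq hdeg hy hΓ (S.vertex_corner v _), h2, component_cutS1]
  have hiff : ∀ f, (S.follow v).SameCycle e f → (S.vertex f = v ↔ S.vertex e = v) := by
    intro f hf
    have h1 := hf.apply_eq_of_invariant (h := fun x => Γ.y x = 0 ∧ Γ.cut.component (Γ.center x) = c₀)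
      hinv
    have h2 := hf.apply_eq_of_invariant (h := Γ.y) fun x => by
      rw [follow_apply, S.y_corner hy hturn, Γ.y_s1]
    simp only [← h2, h0, true_and, S.component_center_eq_iff hdeg hy hΓ hsep] at h1
    exact (iff_of_eq h1).symm
  obtain ⟨⟨f, hf, hf'⟩, g, hg, hg'⟩ := he
  exact hg' ((hiff g hg).2 ((hiff f hf).1 hf'))

end Component

variable {v : S.Vertex}

theorem multiCurve_ext {Γ Γ' : S.toRibbonGraph.MultiCurve}
    (hy : ∀ e, Γ.y e ≤ 1) (hy' : ∀ e, Γ'.y e ≤ 1) (h : ∀ e, Γ.y e = 1 ↔ Γ'.y e = 1)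
    (hturn : ∀ e, Γ.y e = 1 → Γ.turn (e, 0) = (S.corner v e, 0))
    (hturn' : ∀ e, Γ'.y e = 1 → Γ'.turn (e, 0) = (S.corner v e, 0)) : Γ = Γ' := by
  have h1 : ∀ e, Γ.y e = Γ'.y e := fun e => by
    have := hy e
    have := hy' e
    have := h e
    omega
  refine MultiCurve.ext (funext h1) (funext fun p => ?_)
  obtain ⟨e, i⟩ := p
  by_cases hi : i < Γ.y e
  · have := hy e
    obtain rfl : i = 0 := by omega
    rw [hturn e (by omega), hturn' e (by rw [← h1]; omega)]
  · rw [Γ.turn_junk _ hi, Γ'.turn_junk _ (by rwa [← h1])]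

/-- The multi-curves that separate `v` along negative boundaries. -/
theorem y_and_turn_of_separates [Finite X] (hdeg : ∀ v, 3 ≤ S.degree v) (hadm : Γ.Admissible)
    {c₀ : Γ.cut.Component} (hsep : Γ.SeparatesVertex v c₀) (hall : Γ.AllCurvesBound c₀)
    (hneg : S.GluedAlongNegative Γ c₀) :
    (∀ e, Γ.y e ≤ 1) ∧ (∀ e, Γ.y e = 1 ↔ S.Crossed v e) ∧
      ∀ e, Γ.y e = 1 → Γ.turn (e, 0) = (S.corner v e, 0) := by
  have hΓ : Γ.TurnsAtCorners := fun p hp => hadm.turn_adjacent hp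
  have hy := S.y_le_one hΓ hall hneg
  have hturn := fun e => S.turn_eq_corner hdeg hy hΓ hsep hall hneg (e := e)
  exact ⟨hy, fun e => ⟨S.crossed_of_y_eq_one hdeg hy hturn,
    S.y_eq_one_of_crossed hdeg hy hΓ hsep hturn⟩, hturn⟩

end OrientedMetricRibbonGraph

/-! ### Existence: the separating multi-curve -/

namespace OrientedMetricRibbonGraph

open RibbonGraph MultiCurve

variable {X : Type*} (S : OrientedMetricRibbonGraph X) (v : S.Vertex)

open Classical in
/-- Each band is crossed by at most one strand, when the curve that follows it visits `v` and also
another vertex. -/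
noncomputable def separatingY (e : X) : ℕ := if S.Crossed v e then 1 else 0

open Classical in
/-- The strands turn around the positive corners, except at `v` where they turn around the negative
ones. -/
noncomputable def separatingTurn (p : X × ℕ) : X × ℕ :=
  if S.Crossed v p.1 ∧ p.2 = 0 then (S.corner v p.1, 0) else p

variable {v}

theorem separatingY_le_one (e : X) : S.separatingY v e ≤ 1 := by
  unfold separatingY
  split_ifs <;> omega

theorem separatingY_eq_one_iff {e : X} : S.separatingY v e = 1 ↔ S.Crossed v e := by
  unfold separatingY
  split_ifs <;> simp_all

theorem lt_separatingY_iff {p : X × ℕ} :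
    p.2 < S.separatingY v p.1 ↔ S.Crossed v p.1 ∧ p.2 = 0 := by
  unfold separatingY
  split_ifs <;> simp_all

theorem separatingY_s1 (e : X) : S.separatingY v (S.s1 e) = S.separatingY v e := by
  have h1 := S.separatingY_le_one (v := v) e
  have h2 := S.separatingY_le_one (v := v) (S.s1 e)
  have h3 := S.crossed_s1 (v := v) (e := e)
  rw [← separatingY_eq_one_iff, ← separatingY_eq_one_iff] at h3
  omega

theorem separatingTurn_of_lt {p : X × ℕ} (h : p.2 < S.separatingY v p.1) :
    S.separatingTurn v p = (S.corner v p.1, 0) :=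
  if_pos (S.lt_separatingY_iff.1 h)

theorem separatingTurn_lt {p : X × ℕ} (h : p.2 < S.separatingY v p.1) :
    (S.separatingTurn v p).2 < S.separatingY v (S.separatingTurn v p).1 := by
  rw [S.separatingTurn_of_lt h, lt_separatingY_iff]
  exact ⟨S.crossed_corner.2 (S.lt_separatingY_iff.1 h).1, rfl⟩

theorem separatingTurn_separatingTurn (p : X × ℕ) :
    S.separatingTurn v (S.separatingTurn v p) = p := by
  by_cases h : p.2 < S.separatingY v p.1
  · rw [S.separatingTurn_of_lt (S.separatingTurn_lt h), S.separatingTurn_of_lt h, corner_corner]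
    exact Prod.ext rfl (S.lt_separatingY_iff.1 h).2.symm
  · have h1 : S.separatingTurn v p = p := if_neg (by rwa [← lt_separatingY_iff])
    rw [h1, h1]

theorem nextStrand_separating {e : X} (he : S.Crossed v e) (k : ℕ) :
    (S.nextStrand (S.separatingY v) (S.separatingTurn v))^[k] (e, 0) =
      ((S.follow v ^ k) e, 0) := by
  induction k generalizing e with
  | zero => rfl
  | succ k ih =>
    have h1 : S.nextStrand (S.separatingY v) (S.separatingTurn v) (e, 0) = (S.follow v e, 0) := by
      have h2 : S.separatingY v e = 1 := S.separatingY_eq_one_iff.2 he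
      rw [nextStrand, reverseStrand, h2]
      exact if_pos ⟨S.crossed_s1.2 he, rfl⟩
    rw [Function.iterate_succ_apply, h1, ih (S.crossed_follow.2 he), pow_succ,
      Equiv.Perm.mul_apply]

/-- Each arc joins the only strands of two adjacent bands, which are consecutive around the disc, so
no other arc can separate its ends. -/
theorem noncrossing_separating {p q : X × ℕ}
    (hp : p.2 < S.separatingY v p.1) (hq : q.2 < S.separatingY v q.1)
    (h : S.InArc (S.separatingY v) p (S.separatingTurn v p) q) :
    S.InArc (S.separatingY v) p (S.separatingTurn v p) (S.separatingTurn v q) := by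
  have hne : S.separatingTurn v p ≠ q := by
    obtain ⟨k, hk, h⟩ := h
    rw [← hk]
    exact (h k le_rfl).symm
  have hturn := S.separatingTurn_of_lt hq
  have hqp : S.separatingTurn v q ≠ p := fun h' => hne (by
    rw [← h', S.separatingTurn_separatingTurn])
  obtain ⟨e, i⟩ := p
  obtain ⟨f, j⟩ := q
  obtain ⟨he, rfl⟩ : S.Crossed v e ∧ i = 0 := S.lt_separatingY_iff.1 hp
  obtain ⟨hf, rfl⟩ : S.Crossed v f ∧ j = 0 := S.lt_separatingY_iff.1 hq
  have hy := S.separatingY_eq_one_iff.2 hf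
  rcases S.corner_eq_or v f with hc | hc
  · have h1 := inArc_clockwise h
    rw [clockwise, if_pos hq] at h1
    have h2 := inArc_clockwise (h1.resolve_left (by
      rw [S.separatingTurn_of_lt hp]
      simp))
    rw [clockwise, if_neg (by simp [hy]), ← hc, ← hturn] at h2
    -- Landing on the end of the arc of `p` would force `q = p`; but the walk from `p` meets that
    -- end after one step, before it comes back to `q`.
    refine h2.resolve_left fun h3 => ?_
    have h4 := congrArg (S.separatingTurn v) h3
    rw [S.separatingTurn_separatingTurn, S.separatingTurn_separatingTurn] at h4
    obtain rfl : f = e := congrArg Prod.fst h4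
    obtain ⟨k, hk, h⟩ := h
    cases k with
    | zero => simp [Prod.ext_iff] at hk
    | succ k =>
      refine h 1 (by omega) ?_
      rw [Function.iterate_one, clockwise, if_neg (by simp [hy]), ← hc, S.separatingTurn_of_lt hp]
  · rw [hturn]
    have hg : S.separatingY v (S.corner v f) = 1 :=
      S.separatingY_eq_one_iff.2 (S.crossed_corner.2 hf)
    -- Here the arc of `q` goes counterclockwise, so the walk is traced back from `(f, 0)` through
    -- strip `1` to strip `0` of the preceding band. It cannot start at that strip `1`, since `p`
    -- would then be the other end of the arc of `q`.
    have hprev : ∀ {a : X × ℕ}, S.clockwise (S.separatingY v) a = (f, 0) →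
        ∃ m, a = (S.corner v f, m + 1) := by
      intro a ha
      unfold clockwise at ha
      split_ifs at ha with hlt
      · simp [Prod.ext_iff] at ha
      · have h1 : S.corner v f = a.1 := by
          rw [hc, S.s0_inv_eq_iff]
          exact (congrArg Prod.fst ha).symm
        rw [← h1, hg] at hlt
        exact ⟨a.2 - 1, Prod.ext h1.symm (by simp only; omega)⟩
    obtain ⟨k, hk, h⟩ := h
    cases k with
    | zero => simp [Prod.ext_iff] at hk
    | succ k =>
      rw [Function.iterate_succ_apply'] at hk
      obtain ⟨m, hm⟩ := hprev hk
      cases k with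
      | zero =>
        have he' : S.corner v f = e := (congrArg Prod.fst hm).symm
        exact absurd (hturn.trans (by rw [he'])) hqp
      | succ k =>
        rw [Function.iterate_succ_apply'] at hm
        have hm1 := clockwise_eq_succ hm
        obtain rfl : m = 0 := by
          rw [hm1, clockwise] at hm
          split_ifs at hm with hlt
          · simp only [hg] at hlt
            omega
          · simp [Prod.ext_iff] at hm
        exact ⟨k, hm1, fun l hl => h l (by omega)⟩

/-- The multi-curve that separates the vertex `v` from the rest of the surface along negative
boundaries. -/
noncomputable def separatingMultiCurve [Finite X] (hdeg : ∀ v, 3 ≤ S.degree v) (v : S.Vertex) :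
    S.toRibbonGraph.MultiCurve where
  y := S.separatingY v
  y_s1 := S.separatingY_s1
  turn := S.separatingTurn v
  turn_junk p h := if_neg (by rwa [← lt_separatingY_iff])
  turn_lt _ := S.separatingTurn_lt
  turn_turn := S.separatingTurn_separatingTurn
  turn_vertex p := by
    unfold separatingTurn
    split_ifs
    · exact S.vertex_corner v _
    · rfl
  turn_reduced p hp h := by
    rw [S.separatingTurn_of_lt hp] at h
    have h1 := S.ε_corner v p.1
    rw [show S.corner v p.1 = p.1 from h] at h1
    rcases Int.units_eq_one_or (S.ε p.1) with h2 | h2 <;> rw [h2] at h1 <;> revert h1 <;> decide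
  noncrossing _ _ hp hq := S.noncrossing_separating hp hq
  essential p hp h := by
    obtain ⟨e, i⟩ := p
    obtain ⟨he, rfl⟩ : S.Crossed v e ∧ i = 0 := S.lt_separatingY_iff.1 hp
    have key : ∀ f, (S.follow v).SameCycle e f → (S.vertex f = v ↔ S.ε (S.s1 e) = 1) := by
      intro f hf
      -- Essentiality at step `k` concerns the half-edge reached after `k + 1` steps, so powers are
      -- counted from `follow v e`.
      obtain ⟨k, -, rfl⟩ := ((S.sameCycle_follow v e).symm.trans hf).exists_pow_eq'
      have h1 := h k
      simp only [word, S.nextStrand_separating he] at h1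
      rw [pow_succ', Equiv.Perm.mul_apply, S.s2_follow_eq_iff hdeg] at h1
      have hε : S.ε ((S.follow v ^ k) e) = S.ε e :=
        (Equiv.Perm.SameCycle.apply_eq_of_invariant (h := S.ε) (S.ε_follow v) ⟨k, rfl⟩).symm
      rw [S.ε_s1, hε, ← S.ε_s1] at h1
      rwa [← Equiv.Perm.mul_apply, ← pow_succ, pow_succ', Equiv.Perm.mul_apply]
    obtain ⟨⟨f, hf, hf'⟩, g, hg, hg'⟩ := he
    exact hg' ((key g hg).2 ((key f hf).1 hf'))
  primitive p q hp hq h := by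
    -- With at most one strand per band, the first letter of the word determines the strand.
    refine ⟨0, Or.inl (Prod.ext (h 0).symm ?_)⟩
    exact (S.lt_separatingY_iff.1 hq).2.trans (S.lt_separatingY_iff.1 hp).2.symm

theorem vertex_eq_of_not_crossed {e f : X} (h : ¬ S.Crossed v e) (he : S.vertex e = v)
    (hf : (S.follow v).SameCycle e f) : S.vertex f = v := by
  by_contra hne
  exact h ⟨⟨e, Equiv.Perm.SameCycle.refl _ _, he⟩, f, hf, hne⟩

section

variable [Finite X] (hdeg : ∀ v, 3 ≤ S.degree v)

theorem turn_separating {e : X} (h : (S.separatingMultiCurve hdeg v).y e = 1) :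
    (S.separatingMultiCurve hdeg v).turn (e, 0) = (S.corner v e, 0) :=
  S.separatingTurn_of_lt (p := (e, 0)) (by
    change 0 < (S.separatingMultiCurve hdeg v).y e
    omega)

theorem turnsAtCorners_separating : (S.separatingMultiCurve hdeg v).TurnsAtCorners := by
  intro p hp
  have h1 : (S.separatingMultiCurve hdeg v).turn p = (S.corner v p.1, 0) :=
    S.separatingTurn_of_lt hp
  rw [h1]
  exact S.corner_eq_or v p.1

/-- The strips of the component of `v`: those on the positive side of a curve, and those of the edges
that are not crossed and stay at `v`. -/
def PositiveStrip (a : (S.separatingMultiCurve hdeg v).Strip) : Prop :=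
  (S.Crossed v a.1.1 ∧ (a.1.2 = 0 ↔ S.ε a.1.1 = 1)) ∨
    (¬ S.Crossed v a.1.1 ∧ S.vertex a.1.1 = v)

theorem PositiveStrip.cutS1 {a : (S.separatingMultiCurve hdeg v).Strip}
    (h : S.PositiveStrip hdeg a) :
    S.PositiveStrip hdeg ((S.separatingMultiCurve hdeg v).cutS1 a) := by
  unfold PositiveStrip
  rw [coe_cutS1]
  simp only [S.crossed_s1, S.ε_s1, neg_ε_eq_one_iff]
  rcases h with ⟨h1, h2⟩ | ⟨h1, h2⟩
  · refine Or.inl ⟨h1, ?_⟩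
    have h3 : (S.separatingMultiCurve hdeg v).y a.1.1 = 1 := S.separatingY_eq_one_iff.2 h1
    have h4 := a.2
    rw [h3, Ne, ← h2]
    omega
  · refine Or.inr ⟨h1, ?_⟩
    rw [← S.vertex_corner v, ← follow_apply]
    exact S.vertex_eq_of_not_crossed h1 h2 (S.sameCycle_follow v _)

theorem PositiveStrip.cutS0 {a : (S.separatingMultiCurve hdeg v).Strip}
    (h : S.PositiveStrip hdeg a) :
    S.PositiveStrip hdeg ((S.separatingMultiCurve hdeg v).cutS0 a) := by
  obtain ⟨⟨e, i⟩, hi⟩ := a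
  rcases (show i ≤ (S.separatingMultiCurve hdeg v).y e from hi).lt_or_eq with hlt | heq
  · obtain ⟨he, rfl⟩ : S.Crossed v e ∧ i = 0 :=
      (S.lt_separatingY_iff (p := (e, i))).1 hlt
    have hy := S.separatingY_eq_one_iff.2 he
    have hε : S.ε e = 1 := by
      rcases h with h | h
      · exact h.2.1 rfl
      · exact absurd he h.1
    rw [cutS0_of_lt _ hlt]
    have h1 := S.turn_separating hdeg hy
    refine Or.inl ?_
    simp only [h1, S.crossed_corner, S.ε_corner, he, hε, true_and]
    decide
  · rw [cutS0_last _ heq]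
    by_cases hs : S.Crossed v (S.s0 e)
    · refine Or.inl ⟨hs, ?_⟩
      simp only [true_iff, ε_s0, neg_ε_eq_one_iff]
      -- With `ε e = 1`, a crossed `e` would have strip `0` as its positive strip, not the last one.
      -- An uncrossed `e` at `v` has corner partner `s0 e`, so it would be crossed along with `s0
      -- e`.
      intro hε
      have hnc : ¬ S.Crossed v e := by
        intro he
        have hy : (S.separatingMultiCurve hdeg v).y e = 1 := S.separatingY_eq_one_iff.2 he
        rcases h with h | h
        · have := h.2.2 hε
          simp only at this
          omega
        · exact h.1 he
      rcases h with h | h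
      · exact hnc h.1
      · refine hnc ?_
        rw [← S.crossed_corner, S.corner_of_iff]
        · exact hs
        · exact iff_of_true h.2 hε
    · refine Or.inr ⟨hs, ?_⟩
      simp only [S.vertex_s0]
      rcases h with h | h
      · by_contra hne
        refine hs ?_
        have hy : (S.separatingMultiCurve hdeg v).y e = 1 := S.separatingY_eq_one_iff.2 h.1
        have hε : ¬ S.ε e = 1 := by
          rw [← h.2]
          simp only
          omega
        rw [← S.corner_of_iff (iff_of_false hne hε), S.crossed_corner]
        exact h.1
      · exact h.2

theorem positiveStrip_iff_of_component_eq {a b : (S.separatingMultiCurve hdeg v).Strip}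
    (h : (S.separatingMultiCurve hdeg v).cut.component a =
      (S.separatingMultiCurve hdeg v).cut.component b) :
    S.PositiveStrip hdeg a ↔ S.PositiveStrip hdeg b := by
  refine (S.separatingMultiCurve hdeg v).cut.mem_iff_of_component_eq
    (P := S.PositiveStrip hdeg) (fun c => ⟨fun hc => ?_, PositiveStrip.cutS0 S hdeg⟩)
    (fun c => ⟨fun hc => ?_, PositiveStrip.cutS1 S hdeg⟩) h
  · obtain ⟨n, -, h1⟩ := Equiv.Perm.SameCycle.exists_pow_eq'
      (⟨-1, by simp⟩ : (S.separatingMultiCurve hdeg v).cutS0.SameCycle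
        ((S.separatingMultiCurve hdeg v).cutS0 c) c)
    have h2 : ∀ n : ℕ, S.PositiveStrip hdeg
        (((S.separatingMultiCurve hdeg v).cutS0 ^ n) ((S.separatingMultiCurve hdeg v).cutS0 c)) := by
      intro n
      induction n with
      | zero => exact hc
      | succ n ih => rw [pow_succ']; exact PositiveStrip.cutS0 S hdeg ih
    rw [← h1]
    exact h2 n
  · have h1 := PositiveStrip.cutS1 S hdeg hc
    rwa [show (S.separatingMultiCurve hdeg v).cutS1 ((S.separatingMultiCurve hdeg v).cut.s1 c) = c
      from cutS1_cutS1 _ c] at h1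

theorem positiveStrip_center {e : X} (he : S.vertex e = v) :
    S.PositiveStrip hdeg ((S.separatingMultiCurve hdeg v).center e) := by
  unfold PositiveStrip
  rw [center_fst]
  by_cases hc : S.Crossed v e
  · refine Or.inl ⟨hc, ?_⟩
    have hy : (S.separatingMultiCurve hdeg v).y e = 1 := S.separatingY_eq_one_iff.2 hc
    have hturn := congrArg Prod.fst (S.turn_separating hdeg hy)
    by_cases hε : S.ε e = 1
    · rw [center_of_turn_ne]
      · simp [hε]
      · rw [hturn, S.corner_of_iff (iff_of_true he hε)]
        exact s0_ne_s0_inv hdeg e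
    · rw [center_of_turn_eq _ hy]
      · simp [hε]
      · rw [hturn, S.corner_of_not_iff (by tauto)]
  · exact Or.inr ⟨hc, he⟩

theorem vertex_eq_of_positiveStrip_center {e : X}
    (h : S.PositiveStrip hdeg ((S.separatingMultiCurve hdeg v).center e)) : S.vertex e = v := by
  unfold PositiveStrip at h
  rw [center_fst] at h
  rcases h with ⟨hc, h⟩ | h
  · by_contra hne
    have hy : (S.separatingMultiCurve hdeg v).y e = 1 := S.separatingY_eq_one_iff.2 hc
    have hturn := congrArg Prod.fst (S.turn_separating hdeg hy)
    by_cases hε : S.ε e = 1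
    · rw [center_of_turn_eq _ hy] at h
      · simp [hε] at h
      · rw [hturn, S.corner_of_not_iff (by tauto)]
    · rw [center_of_turn_ne] at h
      · simp [hε] at h
      · rw [hturn, S.corner_of_iff (iff_of_false hne hε)]
        exact s0_ne_s0_inv hdeg e
  · exact h.2

/-- The positive side of every curve lies in the component of `v`. -/
theorem component_eq_of_crossed {e₀ : X} (he₀ : S.vertex e₀ = v) {e : X} (hc : S.Crossed v e)
    (hε : S.ε e = 1) :
    (S.separatingMultiCurve hdeg v).cut.component ⟨(e, 0), Nat.zero_le _⟩ =
      (S.separatingMultiCurve hdeg v).cut.component ((S.separatingMultiCurve hdeg v).center e₀) := by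
  have hy := S.separatingY_le_one (v := v)
  have hcorner := S.turnsAtCorners_separating hdeg (v := v)
  -- At the far end of `e`, the positive strip is central if the vertex is `v`. Elsewhere it lies in
  -- the bigon cut off by the arc, and leads to the positive strip of the next edge of the curve.
  have step : ∀ e, S.Crossed v e → S.ε e = 1 →
      (S.vertex (S.follow v e) ≠ v →
        (S.separatingMultiCurve hdeg v).cut.component ⟨(S.follow v e, 0), Nat.zero_le _⟩ =
          (S.separatingMultiCurve hdeg v).cut.component
            ((S.separatingMultiCurve hdeg v).center e₀)) →
      (S.separatingMultiCurve hdeg v).cut.component ⟨(e, 0), Nat.zero_le _⟩ =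
        (S.separatingMultiCurve hdeg v).cut.component
          ((S.separatingMultiCurve hdeg v).center e₀) := by
    intro e hc hε ih
    have hy1 : (S.separatingMultiCurve hdeg v).y e = 1 := S.separatingY_eq_one_iff.2 hc
    have hy2 : (S.separatingMultiCurve hdeg v).y (S.s1 e) = 1 :=
      S.separatingY_eq_one_iff.2 (S.crossed_s1.2 hc)
    have hε1 : ¬ S.ε (S.s1 e) = 1 := by
      rw [S.ε_s1, hε]
      decide
    have h1 : (S.separatingMultiCurve hdeg v).cutS1 ⟨(e, 0), Nat.zero_le _⟩ =
        ⟨(S.s1 e, 1), hy2.ge⟩ :=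
      Subtype.ext (Prod.ext rfl (by rw [coe_cutS1]; simp [hy1]))
    rw [← component_cutS1, h1]
    by_cases hv : S.vertex (S.s1 e) = v
    · have h2 := center_of_turn_eq _ hy2 ((congrArg Prod.fst (S.turn_separating hdeg hy2)).trans
        (S.corner_of_not_iff (by tauto)))
      rw [← h2]
      exact component_center_eq hdeg hy hcorner (hv.trans he₀.symm)
    · rw [← component_cutS0, cutS0_last _ hy2.symm]
      simp only [follow_apply, S.corner_of_iff (iff_of_false hv hε1)] at ih
      exact ih (by rwa [S.vertex_s0])
  obtain ⟨f, hf, hfv⟩ := hc.1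
  obtain ⟨n, -, hnf⟩ := ((S.sameCycle_follow v e).symm.trans hf).exists_pow_eq'
  clear hf
  induction n generalizing e with
  | zero =>
    rw [pow_zero, Equiv.Perm.one_apply] at hnf
    exact step e hc hε fun h => absurd (hnf ▸ hfv) h
  | succ n ih =>
    refine step e hc hε fun _ =>
      ih (S.crossed_follow.2 hc) ((S.ε_follow v e).trans hε) ?_
    rw [← hnf, pow_succ, Equiv.Perm.mul_apply]

theorem separatingMultiCurve_spec :
    (S.separatingMultiCurve hdeg v).Admissible ∧
      ∃ c₀ : (S.separatingMultiCurve hdeg v).cut.Component,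
        (S.separatingMultiCurve hdeg v).SeparatesVertex v c₀ ∧
          (S.separatingMultiCurve hdeg v).AllCurvesBound c₀ ∧
            S.GluedAlongNegative (S.separatingMultiCurve hdeg v) c₀ := by
  have hy := S.separatingY_le_one (v := v)
  have hcorner := S.turnsAtCorners_separating hdeg (v := v)
  obtain ⟨e₀, he₀⟩ : ∃ e, S.vertex e = v := Quotient.exists_rep v
  have hpos := S.positiveStrip_center hdeg he₀
  refine ⟨admissible_of_turnsAtCorners hdeg hy hcorner,
    (S.separatingMultiCurve hdeg v).cut.component ((S.separatingMultiCurve hdeg v).center e₀),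
    ⟨⟨_, isVertex_center hdeg hy hcorner e₀, ?_, rfl⟩, ?_⟩, ?_, ?_⟩
  · rw [baseVertex_center, he₀]
  · intro w hw hwc
    obtain ⟨f, rfl⟩ := exists_center_of_isVertex hy hcorner hw
    rw [baseVertex_center]
    exact S.vertex_eq_of_positiveStrip_center hdeg
      ((S.positiveStrip_iff_of_component_eq hdeg hwc).2 hpos)
  · intro β hβ
    induction β using Quotient.inductionOn with
    | _ a =>
    have h0 := snd_ne_zero_of_glue_ne hβ
    obtain ⟨⟨e, i⟩, hi⟩ := a
    have hi' : i ≤ (S.separatingMultiCurve hdeg v).y e := hi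
    have hye : (S.separatingMultiCurve hdeg v).y e ≤ 1 := hy e
    obtain rfl : i = 1 := by simp only at h0; omega
    have hye : (S.separatingMultiCurve hdeg v).y e = 1 := by omega
    have hc : S.Crossed v e := S.separatingY_eq_one_iff.1 hye
    by_cases hε : S.ε e = 1
    · right
      change (S.separatingMultiCurve hdeg v).cut.component
        ((S.separatingMultiCurve hdeg v).flip _) = _
      rw [flip_succ hi, component_cutS1]
      exact S.component_eq_of_crossed hdeg he₀ hc hε
    · left
      change (S.separatingMultiCurve hdeg v).cut.component _ = _
      rw [← component_cutS1]
      rw [← S.component_eq_of_crossed hdeg he₀ (S.crossed_s1.2 hc) (by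
        rwa [S.ε_s1, neg_ε_eq_one_iff])]
      refine congrArg _ (Subtype.ext (Prod.ext rfl ?_))
      rw [coe_cutS1]
      simp [hye]
  · intro β hβ hβc a ha
    subst ha
    have h0 := snd_ne_zero_of_glue_ne hβ
    rw [ε_eq_neg_one_iff]
    -- A strip of the component with a curve on its left has nonzero position, so being positive
    -- forces a negative sign; an uncrossed edge has only position `0`.
    rcases (S.positiveStrip_iff_of_component_eq hdeg hβc).2 hpos with h | h
    · exact fun hε => h0 (h.2.2 hε)
    · have h1 : S.separatingY v a.1.1 = 0 := if_neg h.1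
      have h2 : a.1.2 ≤ S.separatingY v a.1.1 := a.2
      omega

end

end OrientedMetricRibbonGraph

theorem theorem2 {X : Type*} [Finite X] (S : OrientedMetricRibbonGraph X)
    (hconn : S.Connected) (hdeg : ∀ v, 3 ≤ S.degree v) (htwo : Nontrivial S.Vertex)
    (v : S.Vertex) :
    ∃! Γ : S.toRibbonGraph.MultiCurve, Γ.Admissible ∧
      ∃ c₀ : Γ.cut.Component,
        Γ.SeparatesVertex v c₀ ∧ Γ.AllCurvesBound c₀ ∧ S.GluedAlongNegative Γ c₀ := by
  refine ⟨S.separatingMultiCurve hdeg v, S.separatingMultiCurve_spec hdeg, ?_⟩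
  rintro Γ ⟨hadm, c₀, hsep, hall, hneg⟩
  obtain ⟨hy, hcrossed, hturn⟩ := S.y_and_turn_of_separates hdeg hadm hsep hall hneg
  exact S.multiCurve_ext hy S.separatingY_le_one
    (fun e => (hcrossed e).trans S.separatingY_eq_one_iff.symm) hturn
    fun e he => S.turn_separating hdeg he
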